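/- Setting. Let $Y=f^*(\mathbf X)+\sigma(\mathbf X)\varepsilon$, where $\mathbf X\in\mathbb R^d$, $\varepsilon\sim\mathcal N(0,1)$ is independent of $\mathbf X$, and $f^*,\sigma$ are measurable. Let $p(\cdot|\mathbf x)$ be the density of $\mathcal N(f^*(\mathbf x),\sigma^2(\mathbf x))$ and $L$ Lebesgue measure on $\mathbb R$. A predictor is a (measurable) map $\Gamma$ from $\mathbb R^d$ to subsets of $\mathbb R$; for $\ell>0$, an optimal predictor $\Gamma^*_\ell$ is one minimizing $\mathbb P(Y\notin\Gamma(\mathbf X))$ among those with $\mathbb E[L(\Gamma(\mathbf X))]\le\ell$. Put $G(t)=\int_{\mathbb R}\mathbb P(p(y|\mathbf X)\ge t)\,dy$ and $\lambda^*_\ell=G^{-1}(\ell)$, where for a non-increasing $H$ on $[0,\infty)$ we write $H^{-1}(\ell)=\inf\{t\ge 0: H(t)\le\ell\}$. For a predictor $\Gamma$, possibly depending also on a variable $\zeta$ independent of $(\mathbf X,Y)$, let $R_\ell(\Gamma)=\mathbb P(Y\notin\Gamma)+\lambda^*_\ell\,\mathbb E[L(\Gamma)]$, $\mathcal E_\ell(\Gamma)=R_\ell(\Gamma)-R_\ell(\Gamma^*_\ell)$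 and $\mathcal H(\Gamma)=\mathbb E[L(\Gamma\,\triangle\,\Gamma^*_\ell(\mathbf X))]$. Assumptions on the model. (1) $0<\sigma_0\le\sigma(\mathbf x)\le\sigma_1<\infty$ for all $\mathbf x$, with $\sigma_0<\sigma_1$; (2) $\mathbb E|f^*(\mathbf X)|<\infty$; (3) for every $y\in\mathbb R$, $t\mapsto\mathbb P(p(y|\mathbf X)\ge t)$ is continuous on $(0,\infty)$. Procedure. For each $n$, let $N=N_n$ and $M=M_n$ be integers, with $N_n\to\infty$ as $n\to\infty$ and $M>4\sqrt N$, let $u=u_n>0$ with $u_n\to0$, and let $s=\log(\min(n,N))$. Let $(\mathbf X_i,Y_i)_{i\le n}$ be an i.i.d. labelled sample, $\mathbf X_{n+1},\dots,\mathbf X_{n+N}$ an i.i.d. unlabelled sample, and $\zeta,\zeta_1,\dots,\zeta_N$ i.i.d. uniform on $[0,u]$, all independent and independent of the test pair $(\mathbf X,Y)$. Let $\hat f$ and $\tilde\sigma$ be (measurable) estimators based on the labelled sample, let $\hat\sigma^2$ be $\tilde\sigma^2$ thresholded to $[s^{-1},s]$, and put $$\hat p(y|\mathbf x,z)=\Big(\tfrac{1}{\sqrt{2\pi}\,\hat\sigma(\mathbf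 x)}\exp\big(-\tfrac{(y-\hat f(\mathbf x))^2}{2\hat\sigma^2(\mathbf x)}\big)+z\Big)\mathbf 1_{\{|y|\le s\}},\qquad \hat G(t)=\frac{2s}{MN}\sum_{k=1}^M\sum_{i=1}^N\mathbf 1_{\{\hat p(y_k|\mathbf X_{n+i},\zeta_i)>t\}},$$ where $y_1,\dots,y_M$ is a grid of $[-s,s]$ with $y_k\in[-s+2s(k-1)/M,\,-s+2sk/M]$ (for instance any regular grid). The empirical predictor is $\hat\Gamma(\mathbf x,z)=\{y:\hat p(y|\mathbf x,z)\ge\hat G^{-1}(\ell)\}$. Theorem. Under (1)-(3), $\mathbf x\mapsto\{y:p(y|\mathbf x)\ge\lambda^*_\ell\}$ is an optimal predictor. Moreover there is a constant $C_2>0$ depending only on $\sigma_0$ such that the following holds for any optimal predictor $\Gamma^*_\ell$. If, as $n\to\infty$, $$\sqrt s\;\mathbb E\big[(\hat f(\mathbf X)-f^*(\mathbf X))^2\big]\to0\quad\text{and}\quad s^{5/2}\;\mathbb E\big[|\hat\sigma^2(\mathbf X)-\sigma^2(\mathbf X)|\big]\to0,$$ then $$\mathbb E[\mathcal E_\ell(\hat\Gamma)]\le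 C_2\,\mathbb E[\mathcal H(\hat\Gamma)]\ \text{ for all } n,\qquad \mathbb E[\mathcal H(\hat\Gamma)]\to0\quad\text{and}\quad \mathbb E[\mathcal E_\ell(\hat\Gamma)]\to0 .$$ (The expectations may be infinite for finitely many $n$.) -/

import Mathlib

open MeasureTheory ProbabilityTheory Filter Topology
open scoped ENNReal symmDiff

noncomputable section

namespace PredInterval

/-! ### The Gaussian model and predictors -/

/-- Law of `(X, Y)` with `Y = f X + σ X * ε`, where `X` has law `μ` and `ε ∼ N(0,1)` is
independent of `X`. -/
def obsLaw {𝒳 : Type*} [MeasurableSpace 𝒳] (μ : Measure 𝒳) (f σ : 𝒳 → ℝ) : Measure (𝒳 × ℝ) :=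
  (μ.prod (gaussianReal 0 1)).map (fun q => (q.1, f q.1 + σ q.1 * q.2))

/-- The conditional density `p(y | x)` of `Y` given `X = x`: the density of `N(f x, (σ x)²)`. -/
def condDensity {𝒳 : Type*} (f σ : 𝒳 → ℝ) (x : 𝒳) (y : ℝ) : ℝ :=
  gaussianPDFReal (f x) (Real.toNNReal (σ x ^ 2)) y

/-- Error rate `P(Y ∉ Γ(X))` of a predictor. -/
def errorRate {𝒳 : Type*} [MeasurableSpace 𝒳] (μ : Measure 𝒳) (f σ : 𝒳 → ℝ)
    (Γ : 𝒳 → Set ℝ) : ℝ≥0∞ :=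
  obsLaw μ f σ {q | q.2 ∉ Γ q.1}

/-- Expected Lebesgue measure `E[L(Γ(X))]` of a predictor. -/
def expLength {𝒳 : Type*} [MeasurableSpace 𝒳] (μ : Measure 𝒳) (Γ : 𝒳 → Set ℝ) : ℝ≥0∞ :=
  ∫⁻ x, volume (Γ x) ∂μ

/-- A predictor is measurable when `{(x, y) | y ∈ Γ x}` is a measurable set. -/
def MeasurablePredictor {𝒳 : Type*} [MeasurableSpace 𝒳] (Γ : 𝒳 → Set ℝ) : Prop :=
  MeasurableSet {q : 𝒳 × ℝ | q.2 ∈ Γ q.1}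

/-- `Γ` minimizes the error rate among the predictors of expected length at most `ℓ`. -/
def IsOptimalPredictor {𝒳 : Type*} [MeasurableSpace 𝒳] (μ : Measure 𝒳) (f σ : 𝒳 → ℝ) (ℓ : ℝ)
    (Γ : 𝒳 → Set ℝ) : Prop :=
  MeasurablePredictor Γ ∧ expLength μ Γ ≤ ENNReal.ofReal ℓ ∧
    ∀ Γ' : 𝒳 → Set ℝ, MeasurablePredictor Γ' → expLength μ Γ' ≤ ENNReal.ofReal ℓ →
      errorRate μ f σ Γ ≤ errorRate μ f σ Γ'

/-- Generalized inverse of a non-increasing function on `[0, ∞)`. -/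
def genInv {α : Type*} [LE α] (G : ℝ → α) (l : α) : ℝ :=
  sInf {t : ℝ | 0 ≤ t ∧ G t ≤ l}

/-- `G(t) = ∫ P(p(y | X) ≥ t) dy`. -/
def bigG {𝒳 : Type*} [MeasurableSpace 𝒳] (μ : Measure 𝒳) (f σ : 𝒳 → ℝ) (t : ℝ) : ℝ≥0∞ :=
  ∫⁻ y : ℝ, μ {x | t ≤ condDensity f σ x y}

/-- The threshold `λ*_ℓ = G⁻¹(ℓ)`. -/
def lamStar {𝒳 : Type*} [MeasurableSpace 𝒳] (μ : Measure 𝒳) (f σ : 𝒳 → ℝ) (ℓ : ℝ) : ℝ :=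
  genInv (bigG μ f σ) (ENNReal.ofReal ℓ)

/-- The level-set predictor `x ↦ {y | p(y | x) ≥ λ*_ℓ}`. -/
def levelPredictor {𝒳 : Type*} [MeasurableSpace 𝒳] (μ : Measure 𝒳) (f σ : 𝒳 → ℝ) (ℓ : ℝ)
    (x : 𝒳) : Set ℝ :=
  {y | lamStar μ f σ ℓ ≤ condDensity f σ x y}

/-- The risk `P(Y ∉ Γ(X)) + lam * E[L(Γ(X))]`. -/
def risk {𝒳 : Type*} [MeasurableSpace 𝒳] (μ : Measure 𝒳) (f σ : 𝒳 → ℝ) (lam : ℝ)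
    (Γ : 𝒳 → Set ℝ) : ℝ≥0∞ :=
  errorRate μ f σ Γ + ENNReal.ofReal lam * expLength μ Γ

/-! ### Randomized predictors: functions of `(X, ζ)`, where `ζ ∼ ν` is independent of `(X, Y)` -/

/-- Risk `R_ℓ(Γ)` of a randomized predictor: the covariate is `(X, ζ)`, and `Y` depends on it
through `X` only. -/
def randRisk {𝒳 : Type*} [MeasurableSpace 𝒳] (μ : Measure 𝒳) (f σ : 𝒳 → ℝ) (ν : Measure ℝ)
    (ℓ : ℝ) (Γ : 𝒳 × ℝ → Set ℝ) : ℝ≥0∞ :=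
  risk (μ.prod ν) (fun w => f w.1) (fun w => σ w.1) (lamStar μ f σ ℓ) Γ

/-- Excess risk `R_ℓ(Γ) - R_ℓ(Γ*)`. -/
def excessRisk {𝒳 : Type*} [MeasurableSpace 𝒳] (μ : Measure 𝒳) (f σ : 𝒳 → ℝ) (ν : Measure ℝ)
    (ℓ : ℝ) (Γs : 𝒳 → Set ℝ) (Γ : 𝒳 × ℝ → Set ℝ) : EReal :=
  (randRisk μ f σ ν ℓ Γ : EReal) - (risk μ f σ (lamStar μ f σ ℓ) Γs : EReal)

/-- Expected symmetric-difference length `E[L(Γ(X, ζ) ∆ Γ*(X))]`. -/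
def symmDiffLength {𝒳 : Type*} [MeasurableSpace 𝒳] (μ : Measure 𝒳) (ν : Measure ℝ)
    (Γs : 𝒳 → Set ℝ) (Γ : 𝒳 × ℝ → Set ℝ) : ℝ≥0∞ :=
  ∫⁻ w, volume (Γ w ∆ Γs w.1) ∂(μ.prod ν)

/-- Expectation `E[Z⁺] - E[Z⁻]` of an extended real random variable. -/
def eexpect {Ω : Type*} [MeasurableSpace Ω] (P : Measure Ω) (Z : Ω → EReal) : EReal :=
  ((∫⁻ ω, (Z ω).toENNReal ∂P : ℝ≥0∞) : EReal) - ((∫⁻ ω, (-Z ω).toENNReal ∂P : ℝ≥0∞) : EReal)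

/-! ### The empirical prediction interval -/

/-- The variance estimate `v` thresholded to `[s⁻¹, s]`. -/
def threshold (s v : ℝ) : ℝ :=
  (if s⁻¹ ≤ v ∧ v ≤ s then v else 0) + (if v < s⁻¹ then s⁻¹ else 0) + (if s < v then s else 0)

/-- Randomized, truncated plug-in density `p̂(y | x, z)`; `fh` is the estimate of `f`, and `st` is
the estimate of `σ` before thresholding. -/
def plugInDensity {𝒳 : Type*} (s : ℝ) (fh st : 𝒳 → ℝ) (x : 𝒳) (z y : ℝ) : ℝ :=
  if |y| ≤ s then gaussianPDFReal (fh x) (Real.toNNReal (threshold s (st x ^ 2))) y + z else 0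

/-- `Ĝ(t) = 2s/(MN) ∑ₖ ∑ᵢ 1{p̂(yₖ | Xᵢ, ζᵢ) > t}`, with `yₖ` the points of the grid. -/
def empG {𝒳 : Type*} {M N : ℕ} (s : ℝ) (grid : Fin M → ℝ) (fh st : 𝒳 → ℝ) (xs : Fin N → 𝒳)
    (zs : Fin N → ℝ) (t : ℝ) : ℝ :=
  2 * s / (M * N) *
    ∑ k : Fin M, ∑ i : Fin N, if t < plugInDensity s fh st (xs i) (zs i) (grid k) then 1 else 0

/-- `Γ̂(x, z) = {y | p̂(y | x, z) ≥ Ĝ⁻¹(ℓ)}`. -/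
def empPredictor {𝒳 : Type*} {M N : ℕ} (s : ℝ) (grid : Fin M → ℝ) (fh st : 𝒳 → ℝ)
    (xs : Fin N → 𝒳) (zs : Fin N → ℝ) (ℓ : ℝ) (w : 𝒳 × ℝ) : Set ℝ :=
  {y | genInv (empG s grid fh st xs zs) ℓ ≤ plugInDensity s fh st w.1 w.2 y}

/-- One point in each of the `M` consecutive cells of length `2s/M` of `[-s, s]`; the regular grids
(left end points, mid points, or equally spaced points with both ends) are of this form. -/
def IsGrid {M : ℕ} (s : ℝ) (grid : Fin M → ℝ) : Prop :=
  ∀ k : Fin M, grid k ∈ Set.Icc (-s + 2 * s * k / M) (-s + 2 * s * (k + 1) / M)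

/-- Uniform distribution on `[0, u]`. -/
def unifLaw (u : ℝ) : Measure ℝ := volume[|Set.Icc 0 u]

/-- Law of the labelled sample of size `n`. -/
def labelledLaw {𝒳 : Type*} [MeasurableSpace 𝒳] (μ : Measure 𝒳) (f σ : 𝒳 → ℝ) (n : ℕ) :
    Measure (Fin n → 𝒳 × ℝ) :=
  Measure.pi fun _ => obsLaw μ f σ

/-- Law of all the data: the labelled sample, the unlabelled sample of size `N`, and the `N`
perturbations, mutually independent. -/
def dataLaw {𝒳 : Type*} [MeasurableSpace 𝒳] (μ : Measure 𝒳) (f σ : 𝒳 → ℝ) (n N : ℕ) (u : ℝ) :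
    Measure ((Fin n → 𝒳 × ℝ) × (Fin N → 𝒳) × (Fin N → ℝ)) :=
  (labelledLaw μ f σ n).prod ((Measure.pi fun _ => μ).prod (Measure.pi fun _ => unifLaw u))

/-- The truncation level `s = log (min n N)`. -/
def truncLevel (n N : ℕ) : ℝ := Real.log ((min n N : ℕ) : ℝ)

/-- The empirical predictor computed from the data `D`, with estimators `fh`, `st` based on the
labelled part of `D`. -/
def dataPredictor {𝒳 : Type*} {n N M : ℕ} (grid : Fin M → ℝ) (fh st : (Fin n → 𝒳 × ℝ) → 𝒳 → ℝ)
    (ℓ : ℝ) (D : (Fin n → 𝒳 × ℝ) × (Fin N → 𝒳) × (Fin N → ℝ)) : 𝒳 × ℝ → Set ℝ :=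
  empPredictor (truncLevel n N) grid (fh D.1) (st D.1) D.2.1 D.2.2 ℓ

/-- `E[𝓔_ℓ(Γ̂)]`. -/
def expExcessRisk {𝒳 : Type*} [MeasurableSpace 𝒳] {n M : ℕ} (μ : Measure 𝒳) (f σ : 𝒳 → ℝ)
    (N : ℕ) (u : ℝ) (grid : Fin M → ℝ) (fh st : (Fin n → 𝒳 × ℝ) → 𝒳 → ℝ) (ℓ : ℝ)
    (Γs : 𝒳 → Set ℝ) : EReal :=
  eexpect (dataLaw μ f σ n N u) fun D =>
    excessRisk μ f σ (unifLaw u) ℓ Γs (dataPredictor grid fh st ℓ D)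

/-- `E[𝓗(Γ̂)]`. -/
def expSymmDiffLength {𝒳 : Type*} [MeasurableSpace 𝒳] {n M : ℕ} (μ : Measure 𝒳) (f σ : 𝒳 → ℝ)
    (N : ℕ) (u : ℝ) (grid : Fin M → ℝ) (fh st : (Fin n → 𝒳 × ℝ) → 𝒳 → ℝ) (ℓ : ℝ)
    (Γs : 𝒳 → Set ℝ) : ℝ≥0∞ :=
  ∫⁻ D, symmDiffLength μ (unifLaw u) Γs (dataPredictor grid fh st ℓ D) ∂(dataLaw μ f σ n N u)

/-- `E[(f̂(X) - f(X))²]`. -/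
def regressionError {𝒳 : Type*} [MeasurableSpace 𝒳] {n : ℕ} (μ : Measure 𝒳) (f σ : 𝒳 → ℝ)
    (fh : (Fin n → 𝒳 × ℝ) → 𝒳 → ℝ) : ℝ≥0∞ :=
  ∫⁻ D, ∫⁻ x, ENNReal.ofReal ((fh D x - f x) ^ 2) ∂μ ∂(labelledLaw μ f σ n)

/-- `E|σ̂²(X) - σ²(X)|`, with `σ̂²` the thresholded estimate at level `s`. -/
def varianceError {𝒳 : Type*} [MeasurableSpace 𝒳] {n : ℕ} (μ : Measure 𝒳) (f σ : 𝒳 → ℝ) (s : ℝ)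
    (st : (Fin n → 𝒳 × ℝ) → 𝒳 → ℝ) : ℝ≥0∞ :=
  ∫⁻ D, ∫⁻ x, ENNReal.ofReal |threshold s (st D x ^ 2) - σ x ^ 2| ∂μ ∂(labelledLaw μ f σ n)

end PredInterval

end

open PredInterval

/-! With respect to `μ.prod volume` the law of (X, Y) has density p(y | x), so minimizing the error
at bounded length is a Neyman-Pearson problem. Continuity of t ↦ P(p(y | X) ≥ t) means that no level
t > 0 carries mass (`measure_condDensity_eq`). Hence G(λ*) = ℓ (`bigG_lamStar`), and the level set
at λ* is optimal and unique up to null sets, so it can replace any optimal predictor. Both p and λ*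
are at most 1/σ₀, so two risks differ by at most 2/σ₀ times the expected length of the symmetric
difference (`risk_le_risk_add`). This bounds the excess risk above and below, and only E[H] → 0
remains.

Freeze the labelled sample, and let Δ be the measure of the points with |y| ≤ s where the plug-in
Gaussian density and p differ by more than δ. G exceeds ℓ at λ* - δ and is below ℓ at λ* + δ
(`bigG_lt_of_lamStar_lt`), with margins measured by some κ > 0. If Δ ≤ κ, the tail |y| > s is small
and Ĝ is accurate at λ* ± 3δ, then the empirical threshold is within 3δ of λ*, and the two level
sets differ only where p is within 5δ of λ*, in the tail, or on the discrepancy set. If Δ > κ,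
accuracy at a third threshold, of population length ℓ + 1, bounds the symmetric difference by 2ℓ + 1
≤ ((2ℓ + 1)/κ) Δ. Both cases give a bound affine in Δ (`symmDiffLength_empPredictor_le`), and Δ is
at most a constant, free of s, times the two estimation errors (`exists_measure_discrepancySet_le`).

Since Ĝ is monotone, three thresholds suffice and Chebyshev replaces a uniform law. Accuracy fails
with probability O(s²/N); there the trivial bound 2s + ℓ costs O(s³/N), which vanishes because s ≤
log N. The grid costs 4s/M, since level sets are intervals. -/

namespace PredInterval

/-! ### Gaussian densities: bounds, Lipschitz dependence on parameters, superlevel sets. -/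

section Gaussian

lemma gaussianPDFReal_toNNReal {v : ℝ} (hv : 0 ≤ v) (m y : ℝ) :
    gaussianPDFReal m v.toNNReal y =
      (√(2 * Real.pi * v))⁻¹ * Real.exp (-(y - m) ^ 2 / (2 * v)) := by
  simp [gaussianPDFReal, Real.coe_toNNReal _ hv]

lemma gaussianPDFReal_le {v w : ℝ} (hw : 0 < w) (h : w ^ 2 ≤ v) (m y : ℝ) :
    gaussianPDFReal m v.toNNReal y ≤ w⁻¹ := by
  have hv : 0 < v := lt_of_lt_of_le (by positivity) h
  rw [gaussianPDFReal_toNNReal hv.le]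
  have h1 : w ≤ √(2 * Real.pi * v) := by
    apply Real.le_sqrt_of_sq_le
    nlinarith [Real.pi_gt_three]
  have h2 : Real.exp (-(y - m) ^ 2 / (2 * v)) ≤ 1 := by
    rw [Real.exp_le_one_iff]
    exact div_nonpos_of_nonpos_of_nonneg (by nlinarith [sq_nonneg (y - m)]) (by positivity)
  calc _ ≤ (√(2 * Real.pi * v))⁻¹ * 1 := by gcongr
    _ ≤ w⁻¹ := by rw [mul_one]; gcongr

lemma sq_mul_exp_neg_sq_div_two_le (x : ℝ) : x ^ 2 * Real.exp (-x ^ 2 / 2) ≤ 1 := by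
  have h1 : x ^ 2 ≤ Real.exp (x ^ 2 / 2) := by
    have := Real.quadratic_le_exp_of_nonneg (x := x ^ 2 / 2) (by positivity)
    nlinarith [sq_nonneg (x ^ 2 / 2 - 1)]
  calc x ^ 2 * Real.exp (-x ^ 2 / 2) ≤ Real.exp (x ^ 2 / 2) * Real.exp (-x ^ 2 / 2) := by gcongr
    _ = 1 := by rw [← Real.exp_add, ← Real.exp_zero]; ring_nf

lemma abs_exp_neg_sq_sub_le (a b : ℝ) :
    |Real.exp (-a ^ 2 / 2) - Real.exp (-b ^ 2 / 2)| ≤ |a - b| := by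
  have hd : ∀ x : ℝ, HasDerivAt (fun x : ℝ => Real.exp (-x ^ 2 / 2))
      (Real.exp (-x ^ 2 / 2) * (-x)) x := by
    intro x
    have h1 : HasDerivAt (fun x : ℝ => -x ^ 2 / 2) (-x) x := by
      have := ((hasDerivAt_pow 2 x).neg).div_const 2
      convert! this using 1
      simp
      ring
    exact h1.exp
  have hb : ∀ x : ℝ, ‖Real.exp (-x ^ 2 / 2) * (-x)‖ ≤ 1 := by
    intro x
    rw [Real.norm_eq_abs, abs_mul, abs_neg, Real.abs_exp]
    have h1 := sq_mul_exp_neg_sq_div_two_le x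
    have h2 : Real.exp (-x ^ 2 / 2) ≤ 1 := by
      rw [Real.exp_le_one_iff]; nlinarith [sq_nonneg x]
    have h3 := Real.exp_pos (-x ^ 2 / 2)
    refine abs_le_of_sq_le_sq' (b := 1) ?_ zero_le_one |>.2
    rw [mul_pow, sq_abs]
    nlinarith
  have := Convex.norm_image_sub_le_of_norm_hasDerivWithin_le (s := Set.univ)
    (fun x _ => (hd x).hasDerivWithinAt) (fun x _ => hb x) convex_univ (Set.mem_univ b)
    (Set.mem_univ a)
  simpa using this

/-- With q = (x r)², the derivative (1 - q) exp(-q/2) stays in [-1, 1] whatever r is; this makes the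
dependence on the variance uniform in y. -/
lemma abs_mul_exp_neg_sq_sub_le (r a b : ℝ) :
    |a * Real.exp (-(a * r) ^ 2 / 2) - b * Real.exp (-(b * r) ^ 2 / 2)| ≤ |a - b| := by
  have hd : ∀ x : ℝ, HasDerivAt (fun x : ℝ => x * Real.exp (-(x * r) ^ 2 / 2))
      ((1 - (x * r) ^ 2) * Real.exp (-(x * r) ^ 2 / 2)) x := by
    intro x
    have h1 : HasDerivAt (fun x : ℝ => -(x * r) ^ 2 / 2) (-x * r ^ 2) x := by
      have := ((((hasDerivAt_id x).mul_const r).pow 2).neg).div_const 2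
      convert! this using 1
      simp
      ring
    have := (hasDerivAt_id x).mul h1.exp
    convert! this using 1
    simp
    ring
  have hb : ∀ x : ℝ, ‖(1 - (x * r) ^ 2) * Real.exp (-(x * r) ^ 2 / 2)‖ ≤ 1 := by
    intro x
    have h1 := sq_mul_exp_neg_sq_div_two_le (x * r)
    have h2 : Real.exp (-(x * r) ^ 2 / 2) ≤ 1 := by
      rw [Real.exp_le_one_iff]; nlinarith [sq_nonneg (x * r)]
    have h3 := Real.exp_pos (-(x * r) ^ 2 / 2)
    rw [Real.norm_eq_abs, abs_le]
    constructor <;> nlinarith [mul_nonneg (sq_nonneg (x * r)) h3.le]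
  have := Convex.norm_image_sub_le_of_norm_hasDerivWithin_le (s := Set.univ)
    (fun x _ => (hd x).hasDerivWithinAt) (fun x _ => hb x) convex_univ (Set.mem_univ b)
    (Set.mem_univ a)
  simpa using this

lemma gaussianPDFReal_eq_mul_exp {v : ℝ} (hv : 0 < v) (m y : ℝ) :
    gaussianPDFReal m v.toNNReal y =
      (√(2 * Real.pi))⁻¹ * ((√v)⁻¹ * Real.exp (-((√v)⁻¹ * (y - m)) ^ 2 / 2)) := by
  rw [gaussianPDFReal_toNNReal hv.le, Real.sqrt_mul (by positivity), mul_inv, mul_assoc]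
  congr 3
  rw [mul_pow, inv_pow, Real.sq_sqrt hv.le]
  field_simp

/-- The Gaussian density is jointly Lipschitz in the mean and in the variance. -/
lemma exists_gaussianPDFReal_lipschitz {v₀ : ℝ} (hv₀ : 0 < v₀) :
    ∃ C : ℝ, 0 < C ∧ ∀ m m' v v' y : ℝ, v₀ ≤ v → v₀ ≤ v' →
      |gaussianPDFReal m v.toNNReal y - gaussianPDFReal m' v'.toNNReal y| ≤
        C * (|m - m'| + |v - v'|) := by
  set w := (√v₀)⁻¹ with hw
  have hs₀ : 0 < √v₀ := Real.sqrt_pos.2 hv₀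
  have hw0 : 0 < w := by positivity
  -- w² pays for moving the mean at a fixed variance, w³ for the Lipschitz constant of v ↦ 1/√v on
  -- [v₀, ∞).
  refine ⟨w ^ 2 + w ^ 3, by positivity, fun m m' v v' y hv hv' => ?_⟩
  have hvp := hv₀.trans_le hv
  have hvp' := hv₀.trans_le hv'
  rw [gaussianPDFReal_eq_mul_exp hvp, gaussianPDFReal_eq_mul_exp hvp', ← mul_sub, abs_mul]
  set a := (√v)⁻¹ with ha
  set b := (√v')⁻¹ with hb
  have hc : |(√(2 * Real.pi))⁻¹| ≤ 1 := by
    rw [abs_of_nonneg (by positivity)]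
    apply inv_le_one_of_one_le₀
    rw [Real.one_le_sqrt]
    linarith [Real.pi_gt_three]
  have haw : a ≤ w := inv_anti₀ hs₀ (Real.sqrt_le_sqrt hv)
  have hbw : b ≤ w := inv_anti₀ hs₀ (Real.sqrt_le_sqrt hv')
  have ha0 : 0 < a := inv_pos.2 (Real.sqrt_pos.2 hvp)
  have hb0 : 0 < b := inv_pos.2 (Real.sqrt_pos.2 hvp')
  have hab : |a - b| ≤ w ^ 3 * |v - v'| := by
    have hva : v * a ^ 2 = 1 := by
      rw [ha, inv_pow, Real.sq_sqrt hvp.le, mul_inv_cancel₀ hvp.ne']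
    have hvb : v' * b ^ 2 = 1 := by
      rw [hb, inv_pow, Real.sq_sqrt hvp'.le, mul_inv_cancel₀ hvp'.ne']
    have h1 : (a - b) * (a + b) = a ^ 2 * b ^ 2 * (v' - v) := by
      linear_combination a ^ 2 * (-hvb) + b ^ 2 * hva
    have h2 : |a - b| * (a + b) = a ^ 2 * b ^ 2 * |v - v'| := by
      rw [← abs_of_pos (add_pos ha0 hb0), ← abs_mul, h1, abs_mul, abs_sub_comm,
        abs_of_pos (by positivity : 0 < a ^ 2 * b ^ 2)]
    have h3 : |a - b| * (a + b) ≤ (w ^ 3 * |v - v'|) * (a + b) := by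
      rw [h2]
      have : a ^ 2 * b ^ 2 ≤ w ^ 3 * (a + b) := by
        calc a ^ 2 * b ^ 2 = (a * b ^ 2) * a := by ring
          _ ≤ (w * w ^ 2) * a := by gcongr
          _ ≤ w ^ 3 * (a + b) := by nlinarith [mul_pos (pow_pos hw0 3) hb0]
      nlinarith [abs_nonneg (v - v')]
    exact le_of_mul_le_mul_right h3 (add_pos ha0 hb0)
  have e1 := abs_mul_exp_neg_sq_sub_le (y - m) a b
  have e2 : |b * Real.exp (-(b * (y - m)) ^ 2 / 2) - b * Real.exp (-(b * (y - m')) ^ 2 / 2)| ≤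
      w ^ 2 * |m - m'| := by
    rw [← mul_sub, abs_mul, abs_of_pos hb0]
    calc _ ≤ b * |b * (y - m) - b * (y - m')| := mul_le_mul_of_nonneg_left (abs_exp_neg_sq_sub_le _ _) hb0.le
      _ = b ^ 2 * |m - m'| := by
        rw [← mul_sub, abs_mul, abs_of_pos hb0, abs_sub_comm m m']
        ring_nf
      _ ≤ _ := by gcongr
  calc _ ≤ 1 * |a * Real.exp (-(a * (y - m)) ^ 2 / 2) - b * Real.exp (-(b * (y - m')) ^ 2 / 2)| := by
        gcongr
    _ ≤ |a - b| + w ^ 2 * |m - m'| := by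
        rw [one_mul]
        exact (abs_sub_le _ (b * Real.exp (-(b * (y - m)) ^ 2 / 2)) _).trans (add_le_add e1 e2)
    _ ≤ _ := by nlinarith [mul_nonneg (pow_pos hw0 3).le (abs_nonneg (m - m')),
        mul_nonneg (pow_pos hw0 2).le (abs_nonneg (v - v'))]

/-- Unimodality; interval level sets are what allows a grid to measure their length. -/
lemma ordConnected_gaussianPDFReal (m : ℝ) (v : NNReal) (t : ℝ) :
    {y | t < gaussianPDFReal m v y}.OrdConnected := by
  constructor
  intro a ha b hb y hy
  obtain ⟨h1, h2⟩ := hy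
  have key : ∀ c : ℝ, (y - m) ^ 2 ≤ (c - m) ^ 2 → gaussianPDFReal m v c ≤ gaussianPDFReal m v y := by
    intro c hc
    simp only [gaussianPDFReal]
    gcongr
  simp only [Set.mem_ofPred_eq] at *
  rcases le_total m y with h | h
  · exact hb.trans_le (key b (by nlinarith))
  · exact ha.trans_le (key a (by nlinarith))

lemma lintegral_gaussianPDFReal_le_one (m : ℝ) (v : NNReal) :
    ∫⁻ y, ENNReal.ofReal (gaussianPDFReal m v y) ≤ 1 := by
  rcases eq_or_ne v 0 with rfl | hv
  · simp
  · exact (lintegral_gaussianPDFReal_eq_one m hv).le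

lemma volume_le_gaussianPDFReal_le (m : ℝ) (v : NNReal) {t : ℝ} (ht : 0 < t) :
    volume {y | t ≤ gaussianPDFReal m v y} ≤ ENNReal.ofReal t⁻¹ := by
  have h := meas_ge_le_lintegral_div (μ := volume)
    (measurable_gaussianPDFReal m v).ennreal_ofReal.aemeasurable
    (ε := ENNReal.ofReal t) (by simpa using ht) (by simp)
  have h2 : {y | t ≤ gaussianPDFReal m v y} =
      {y | ENNReal.ofReal t ≤ ENNReal.ofReal (gaussianPDFReal m v y)} := by
    ext y
    simp [ENNReal.ofReal_le_ofReal_iff (gaussianPDFReal_nonneg m v y)]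
  rw [h2]
  refine h.trans ?_
  rw [ENNReal.ofReal_inv_of_pos ht, ← one_div]
  gcongr
  exact lintegral_gaussianPDFReal_le_one m v

end Gaussian

/-! ### The joint law and its density -/

section Model

lemma condDensity_nonneg {𝒳 : Type*} (f σ : 𝒳 → ℝ) (x : 𝒳) (y : ℝ) : 0 ≤ condDensity f σ x y :=
  gaussianPDFReal_nonneg _ _ _

variable {𝒳 : Type*} [MeasurableSpace 𝒳] {μ : Measure 𝒳} {f σ : 𝒳 → ℝ}

lemma measurable_gaussianPDFReal_comp {Z : Type*} [MeasurableSpace Z] {a v b : Z → ℝ}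
    (ha : Measurable a) (hv : Measurable v) (hb : Measurable b) :
    Measurable fun z => gaussianPDFReal (a z) (v z).toNNReal (b z) :=
  measurable_uncurry_gaussianPDFReal.comp (ha.prodMk (hv.real_toNNReal.prodMk hb))

lemma measurable_condDensity (hf : Measurable f) (hσ : Measurable σ) :
    Measurable fun q : 𝒳 × ℝ => condDensity f σ q.1 q.2 :=
  measurable_gaussianPDFReal_comp (hf.comp measurable_fst) ((hσ.comp measurable_fst).pow_const 2)
    measurable_snd

lemma expLength_eq {Γ : 𝒳 → Set ℝ} (hΓ : MeasurablePredictor Γ) :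
    expLength μ Γ = (μ.prod volume) {q | q.2 ∈ Γ q.1} := by
  rw [Measure.prod_apply hΓ]
  rfl

lemma bigG_eq [IsProbabilityMeasure μ] (hf : Measurable f) (hσ : Measurable σ) (t : ℝ) :
    bigG μ f σ t = (μ.prod volume) {q | t ≤ condDensity f σ q.1 q.2} := by
  rw [Measure.prod_apply_symm (measurableSet_le measurable_const (measurable_condDensity hf hσ))]
  rfl

lemma map_affine_gaussianReal (b a : ℝ) :
    (gaussianReal 0 1).map (fun e => a + b * e) = gaussianReal a (b ^ 2).toNNReal := by
  have : (fun e : ℝ => a + b * e) = (fun e => a + e) ∘ (fun e => b * e) := rfl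
  rw [this, ← Measure.map_map (by fun_prop) (by fun_prop), gaussianReal_map_const_mul,
    gaussianReal_map_const_add]
  congr 1
  · simp
  · ext
    simp [Real.coe_toNNReal _ (sq_nonneg b)]

lemma obsLaw_apply (hf : Measurable f) (hσ : Measurable σ)
    {S : Set (𝒳 × ℝ)} (hS : MeasurableSet S) :
    obsLaw μ f σ S =
      ∫⁻ x, gaussianReal (f x) (σ x ^ 2).toNNReal (Prod.mk x ⁻¹' S) ∂μ := by
  have hm : Measurable fun q : 𝒳 × ℝ => (q.1, f q.1 + σ q.1 * q.2) := by fun_prop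
  rw [obsLaw, Measure.map_apply hm hS, Measure.prod_apply (hm hS)]
  refine lintegral_congr fun x => ?_
  rw [← map_affine_gaussianReal (σ x), Measure.map_apply (by fun_prop) (measurable_prodMk_left hS)]
  rfl

/-- Given X = x the law of Y is Gaussian with nonzero variance, so it has a density on every fibre;
this turns error rates into integrals over the same space as lengths. -/
lemma obsLaw_eq_withDensity (hf : Measurable f) (hσ : Measurable σ) (hpos : ∀ x, 0 < σ x) :
    obsLaw μ f σ =
      (μ.prod volume).withDensity fun q => ENNReal.ofReal (condDensity f σ q.1 q.2) := by
  ext S hS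
  have hd := (measurable_condDensity hf hσ).ennreal_ofReal
  rw [obsLaw_apply hf hσ hS, withDensity_apply _ hS, ← lintegral_indicator hS,
    lintegral_prod _ (hd.indicator hS).aemeasurable]
  refine lintegral_congr fun x => ?_
  have hv : (σ x ^ 2).toNNReal ≠ 0 := by
    have := hpos x
    simp [Real.toNNReal_eq_zero, this.ne']
  rw [gaussianReal_apply _ hv, ← lintegral_indicator (measurable_prodMk_left hS)]
  rfl

lemma isProbabilityMeasure_obsLaw [IsProbabilityMeasure μ] (hf : Measurable f) (hσ : Measurable σ) :
    IsProbabilityMeasure (obsLaw μ f σ) :=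
  Measure.isProbabilityMeasure_map (by fun_prop)

/-- Adding an unused independent covariate does not change the error rate. -/
lemma errorRate_prod [IsProbabilityMeasure μ] (hf : Measurable f) (hσ : Measurable σ)
    (ν : Measure ℝ) [IsProbabilityMeasure ν] {Γ : 𝒳 → Set ℝ} (hΓ : MeasurablePredictor Γ) :
    errorRate (μ.prod ν) (fun w => f w.1) (fun w => σ w.1) (fun w => Γ w.1) =
      errorRate μ f σ Γ := by
  have hm : Measurable fun q : (𝒳 × ℝ) × ℝ => (q.1.1, q.2) := by fun_prop
  have h : obsLaw μ f σ = (obsLaw (μ.prod ν) (fun w => f w.1) (fun w => σ w.1)).map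
      (fun q => (q.1.1, q.2)) := by
    have hp := ((measurePreserving_fst (μ := μ) (ν := ν)).prod
      (MeasurePreserving.id (gaussianReal 0 1))).map_eq
    rw [obsLaw, obsLaw, ← hp, Measure.map_map (by fun_prop) (by fun_prop),
      Measure.map_map hm (by fun_prop)]
    rfl
  rw [errorRate, errorRate, h]
  exact (Measure.map_apply hm hΓ.compl).symm

lemma expLength_prod (ν : Measure ℝ) [IsProbabilityMeasure ν] {Γ : 𝒳 → Set ℝ}
    (hΓ : MeasurablePredictor Γ) :
    expLength (μ.prod ν) (fun w => Γ w.1) = expLength μ Γ := by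
  have hm : Measurable fun x => volume (Γ x) := measurable_measure_prodMk_left hΓ
  exact (measurePreserving_fst (μ := μ) (ν := ν)).lintegral_comp hm

end Model

/-! ### Neyman-Pearson lemma for a density on a general measure space -/

section NeymanPearson

variable {Z : Type*} [MeasurableSpace Z] {W : Measure Z} {p : Z → ℝ≥0∞} {c : ℝ≥0∞} {B : Set Z}

lemma measure_diff_le_measure_diff {A : Set Z} (hA : MeasurableSet A) (hB : MeasurableSet B)
    (hfin : W A ≠ ∞) (hBA : W B ≤ W A) : W (B \ A) ≤ W (A \ B) := by
  rw [← measure_inter_add_sdiff B hA, ← measure_inter_add_sdiff A hB, Set.inter_comm B A] at hBA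
  exact (ENNReal.add_le_add_iff_left
    (ne_top_of_le_ne_top hfin (measure_mono Set.inter_subset_left))).1 hBA

lemma withDensity_diff_superlevel_le (hp : Measurable p) (hB : MeasurableSet B) :
    W.withDensity p (B \ {z | c ≤ p z}) ≤ c * W (B \ {z | c ≤ p z}) := by
  have hm := hB.diff (measurableSet_le measurable_const hp : MeasurableSet {z | c ≤ p z})
  rw [withDensity_apply _ hm, ← setLIntegral_const]
  refine setLIntegral_mono' hm fun z hz => ?_
  exact (not_le.1 hz.2).le

lemma le_withDensity_superlevel_diff (hp : Measurable p) (hB : MeasurableSet B) :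
    c * W ({z | c ≤ p z} \ B) ≤ W.withDensity p ({z | c ≤ p z} \ B) := by
  have hm := (measurableSet_le measurable_const hp : MeasurableSet {z | c ≤ p z}).diff hB
  rw [withDensity_apply _ hm, ← setLIntegral_const]
  exact setLIntegral_mono' hm fun z hz => hz.1

/-- Neyman-Pearson: a superlevel set of the density captures the most mass at a given size. -/
lemma withDensity_compl_superlevel_le (hp : Measurable p) (hB : MeasurableSet B)
    (hfin : W {z | c ≤ p z} ≠ ∞) (hBA : W B ≤ W {z | c ≤ p z}) :
    W.withDensity p {z | c ≤ p z}ᶜ ≤ W.withDensity p Bᶜ := by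
  have hA : MeasurableSet {z | c ≤ p z} := measurableSet_le measurable_const hp
  -- Writing A for the superlevel set, the part outside both sets is common to the two complements;
  -- there remain B \ A, where p < c, and A \ B, where p ≥ c.
  rw [← measure_inter_add_sdiff {z | c ≤ p z}ᶜ hB, ← measure_inter_add_sdiff Bᶜ hA, Set.inter_comm,
    Set.inter_comm Bᶜ, ← Set.sdiff_eq, ← Set.sdiff_eq, Set.sdiff_eq {z | c ≤ p z}ᶜ,
    Set.sdiff_eq Bᶜ, Set.inter_comm Bᶜ]
  refine add_le_add ?_ le_rfl
  calc _ ≤ c * W (B \ {z | c ≤ p z}) := withDensity_diff_superlevel_le hp hB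
    _ ≤ c * W ({z | c ≤ p z} \ B) := by
        exact mul_le_mul_right (measure_diff_le_measure_diff hA hB hfin hBA) c
    _ ≤ _ := le_withDensity_superlevel_diff hp hB

/-- Uniqueness in the Neyman-Pearson lemma when the density has no mass at the level. -/
lemma measure_symmDiff_superlevel_eq_zero (hp : Measurable p) (hB : MeasurableSet B)
    [IsFiniteMeasure (W.withDensity p)] (hc : c ≠ ∞)
    (hfin : W {z | c ≤ p z} ≠ ∞) (hBA : W B ≤ W {z | c ≤ p z}) (hnull : W {z | p z = c} = 0)
    (hle : W.withDensity p Bᶜ ≤ W.withDensity p {z | c ≤ p z}ᶜ) :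
    W (B ∆ {z | c ≤ p z}) = 0 := by
  have hA : MeasurableSet {z | c ≤ p z} := measurableSet_le measurable_const hp
  have hd := measure_diff_le_measure_diff hA hB hfin hBA
  rw [← measure_inter_add_sdiff {z | c ≤ p z}ᶜ hB, ← measure_inter_add_sdiff Bᶜ hA, Set.inter_comm,
    Set.inter_comm _ B, ← Set.sdiff_eq, ← Set.sdiff_eq, Set.sdiff_eq {z | c ≤ p z}ᶜ,
    Set.sdiff_eq Bᶜ, Set.inter_comm Bᶜ, ENNReal.add_le_add_iff_right (measure_ne_top _ _)] at hle
  -- Almost everywhere on this difference p exceeds c strictly, so positive measure would give the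
  -- superlevel set a strictly smaller error than B.
  have h0 : W ({z | c ≤ p z} \ B) = 0 := by
    by_contra hne
    have hfin' : W ({z | c ≤ p z} \ B) ≠ ∞ :=
      ne_top_of_le_ne_top hfin (measure_mono Set.sdiff_subset)
    have hlt : ∫⁻ _ in {z | c ≤ p z} \ B, c ∂W < ∫⁻ z in {z | c ≤ p z} \ B, p z ∂W := by
      refine setLIntegral_strict_mono (hA.diff hB) hne hp ?_ ?_
      · rw [setLIntegral_const]
        exact ENNReal.mul_ne_top hc hfin'
      · have : ∀ᵐ z ∂W, p z ≠ c := by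
          rw [ae_iff]
          simpa using hnull
        filter_upwards [this] with z hz hz'
        exact lt_of_le_of_ne hz'.1 hz.symm
    rw [setLIntegral_const, ← withDensity_apply _ (hA.diff hB)] at hlt
    refine absurd hlt (not_lt.2 ?_)
    calc _ ≤ _ := hle
      _ ≤ c * W (B \ {z | c ≤ p z}) := withDensity_diff_superlevel_le hp hB
      _ ≤ _ := by gcongr
  rw [Set.symmDiff_def]
  refine measure_union_null ?_ h0
  rw [h0] at hd
  exact le_antisymm hd zero_le

end NeymanPearson

/-! ### The function G near the threshold λ* -/

section Threshold

variable {𝒳 : Type*} [MeasurableSpace 𝒳] {μ : Measure 𝒳} {f σ : 𝒳 → ℝ}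

lemma continuous_gaussianPDFReal (m : ℝ) (v : NNReal) : Continuous (gaussianPDFReal m v) := by
  unfold gaussianPDFReal
  fun_prop

lemma tendsto_gaussianPDFReal_atTop (m : ℝ) {v : NNReal} (hv : v ≠ 0) :
    Tendsto (gaussianPDFReal m v) atTop (𝓝 0) := by
  have hv' : 0 < (v : ℝ) := by positivity
  have h1 : Tendsto (fun y : ℝ => -(y - m) ^ 2 / (2 * (v : ℝ))) atTop atBot := by
    have h2 : Tendsto (fun y : ℝ => (y - m) ^ 2) atTop atTop :=
      (tendsto_pow_atTop two_ne_zero).comp (tendsto_atTop_add_const_right _ (-m) tendsto_id)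
    exact (tendsto_neg_atTop_atBot.comp h2).atBot_div_const (by positivity)
  have := (Real.tendsto_exp_atBot.comp h1).const_mul (√(2 * Real.pi * v))⁻¹
  rw [mul_zero] at this
  exact this

lemma bigG_le_inv [IsProbabilityMeasure μ] (hf : Measurable f) (hσ : Measurable σ) {t : ℝ}
    (ht : 0 < t) : bigG μ f σ t ≤ ENNReal.ofReal t⁻¹ := by
  rw [bigG_eq hf hσ, Measure.prod_apply
    (measurableSet_le measurable_const (measurable_condDensity hf hσ))]
  refine (lintegral_mono fun x => volume_le_gaussianPDFReal_le (f x) (σ x ^ 2).toNNReal ht).trans ?_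
  simp

lemma bigG_ne_top [IsProbabilityMeasure μ] (hf : Measurable f) (hσ : Measurable σ) {t : ℝ}
    (ht : 0 < t) : bigG μ f σ t ≠ ∞ :=
  ne_top_of_le_ne_top ENNReal.ofReal_ne_top (bigG_le_inv hf hσ ht)

lemma bigG_antitone [IsProbabilityMeasure μ] (hf : Measurable f) (hσ : Measurable σ) :
    Antitone (bigG μ f σ) := by
  intro s t hst
  rw [bigG_eq hf hσ, bigG_eq hf hσ]
  exact measure_mono fun q hq => hst.trans hq

/-- For s > t, {s ≤ h} lies inside {t < h}; letting s decrease to t, continuity gives μ{t ≤ h} ≤ μ{t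
< h}. -/
lemma measure_fiber_eq_zero_of_continuousAt [IsProbabilityMeasure μ] {h : 𝒳 → ℝ}
    (hh : Measurable h) {t : ℝ} (hc : ContinuousAt (fun t : ℝ => μ {x | t ≤ h x}) t) :
    μ {x | h x = t} = 0 := by
  have h1 : μ {x | t ≤ h x} ≤ μ {x | t < h x} := by
    refine le_of_tendsto (hc.tendsto.mono_left (nhdsWithin_le_nhds (s := Set.Ioi t))) ?_
    filter_upwards [self_mem_nhdsWithin] with s hs
    exact measure_mono fun x hx => (Set.mem_Ioi.1 hs).trans_le hx
  have h3 : {x | h x = t} = {x | t ≤ h x} \ {x | t < h x} := by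
    ext x
    simp [le_antisymm_iff, and_comm]
  have h4 : {x | t < h x} ⊆ {x | t ≤ h x} := fun x hx => LT.lt.le (a := t) hx
  rw [h3, measure_sdiff h4 (measurableSet_lt measurable_const hh).nullMeasurableSet
    (measure_ne_top _ _)]
  exact tsub_eq_zero_of_le h1

lemma measure_condDensity_eq [IsProbabilityMeasure μ] (hf : Measurable f) (hσ : Measurable σ)
    (hc : ∀ y : ℝ, ContinuousOn (fun t : ℝ => μ {x | t ≤ condDensity f σ x y}) (Set.Ioi 0))
    {t : ℝ} (ht : 0 < t) : (μ.prod volume) {q | condDensity f σ q.1 q.2 = t} = 0 := by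
  have hm := measurable_condDensity hf hσ
  have hs : MeasurableSet {q : 𝒳 × ℝ | condDensity f σ q.1 q.2 = t} :=
    hm (measurableSet_singleton t)
  rw [Measure.prod_apply_symm hs]
  have h0 : ∀ y : ℝ, μ ((fun x => (x, y)) ⁻¹' {q : 𝒳 × ℝ | condDensity f σ q.1 q.2 = t}) = 0 :=
    fun y => measure_fiber_eq_zero_of_continuousAt (hm.comp measurable_prodMk_right)
      ((hc y).continuousAt (Ioi_mem_nhds ht))
  simp only [h0, lintegral_zero]

/-- The density is positive everywhere, so its superlevel sets at 1/(n+1) exhaust a space of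
infinite measure. This is what makes λ* positive. -/
lemma exists_lt_bigG [IsProbabilityMeasure μ] (hf : Measurable f) (hσ : Measurable σ)
    (hpos : ∀ x, 0 < σ x) {c : ℝ≥0∞} (hc : c ≠ ∞) : ∃ t, 0 < t ∧ c < bigG μ f σ t := by
  have h1 : Tendsto (fun n : ℕ => (μ.prod volume) {q | 1 / ((n : ℝ) + 1) ≤ condDensity f σ q.1 q.2})
      atTop (𝓝 ((μ.prod volume) (⋃ n : ℕ, {q | 1 / ((n : ℝ) + 1) ≤ condDensity f σ q.1 q.2}))) := by
    apply tendsto_measure_iUnion_atTop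
    intro m n hmn q hq
    simp only [Set.mem_ofPred_eq] at hq ⊢
    exact (Nat.one_div_le_one_div (α := ℝ) hmn).trans hq
  have h2 : (⋃ n : ℕ, {q : 𝒳 × ℝ | 1 / ((n : ℝ) + 1) ≤ condDensity f σ q.1 q.2}) = Set.univ := by
    refine Set.eq_univ_of_forall fun q => ?_
    have hq : 0 < condDensity f σ q.1 q.2 := by
      refine gaussianPDFReal_pos _ _ _ ?_
      have := hpos q.1
      simp [Real.toNNReal_eq_zero, this.ne']
    obtain ⟨n, hn⟩ := exists_nat_one_div_lt hq
    exact Set.mem_iUnion.2 ⟨n, hn.le⟩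
  have h3 : (μ.prod (volume : Measure ℝ)) Set.univ = ∞ := by
    rw [← Set.univ_prod_univ, Measure.prod_prod]
    simp
  rw [h2, h3] at h1
  obtain ⟨n, hn⟩ := (h1.eventually_const_lt hc.lt_top).exists
  exact ⟨1 / ((n : ℝ) + 1), by positivity, by rwa [bigG_eq hf hσ]⟩

lemma genInv_bddBelow {α : Type*} [LE α] (G : ℝ → α) (l : α) :
    BddBelow {t : ℝ | 0 ≤ t ∧ G t ≤ l} := ⟨0, fun _ h => h.1⟩

lemma lamStar_nonempty [IsProbabilityMeasure μ] (hf : Measurable f) (hσ : Measurable σ) {ℓ : ℝ}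
    (hℓ : 0 < ℓ) : {t : ℝ | 0 ≤ t ∧ bigG μ f σ t ≤ ENNReal.ofReal ℓ}.Nonempty :=
  ⟨ℓ⁻¹, by positivity, by simpa using bigG_le_inv (μ := μ) hf hσ (inv_pos.2 hℓ)⟩

lemma lt_bigG_of_lt_lamStar {ℓ t : ℝ} (h0 : 0 ≤ t) (ht : t < lamStar μ f σ ℓ) :
    ENNReal.ofReal ℓ < bigG μ f σ t := by
  by_contra h
  exact absurd (csInf_le (genInv_bddBelow _ _) ⟨h0, not_lt.1 h⟩) (not_le.2 ht)

lemma bigG_le_of_lamStar_lt [IsProbabilityMeasure μ] (hf : Measurable f) (hσ : Measurable σ)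
    {ℓ t : ℝ} (hℓ : 0 < ℓ) (ht : lamStar μ f σ ℓ < t) : bigG μ f σ t ≤ ENNReal.ofReal ℓ := by
  obtain ⟨s, hs, hst⟩ := exists_lt_of_csInf_lt (lamStar_nonempty hf hσ hℓ) ht
  exact (bigG_antitone hf hσ hst.le).trans hs.2

lemma lamStar_pos [IsProbabilityMeasure μ] (hf : Measurable f) (hσ : Measurable σ)
    (hpos : ∀ x, 0 < σ x) {ℓ : ℝ} (hℓ : 0 < ℓ) : 0 < lamStar μ f σ ℓ := by
  obtain ⟨t, ht, h⟩ := exists_lt_bigG (μ := μ) hf hσ hpos (c := ENNReal.ofReal ℓ) ENNReal.ofReal_ne_top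
  refine ht.trans_le (not_lt.1 fun h' => ?_)
  exact absurd (bigG_le_of_lamStar_lt hf hσ hℓ h') (not_le.2 h)

lemma tendsto_measure_condDensity_near [IsProbabilityMeasure μ] (hf : Measurable f)
    (hσ : Measurable σ)
    (hc : ∀ y : ℝ, ContinuousOn (fun t : ℝ => μ {x | t ≤ condDensity f σ x y}) (Set.Ioi 0))
    {t : ℝ} (ht : 0 < t) :
    Tendsto (fun n : ℕ => (μ.prod volume) {q | |condDensity f σ q.1 q.2 - t| ≤ t / ((n : ℝ) + 2)})
      atTop (𝓝 0) := by
  have hm := measurable_condDensity hf hσ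
  have hi : (⋂ n : ℕ, {q : 𝒳 × ℝ | |condDensity f σ q.1 q.2 - t| ≤ t / ((n : ℝ) + 2)}) =
      {q | condDensity f σ q.1 q.2 = t} := by
    ext q
    simp only [Set.mem_iInter, Set.mem_ofPred_eq]
    constructor
    · intro h
      have hl : Tendsto (fun n : ℕ => t / ((n : ℝ) + 2)) atTop (𝓝 0) :=
        tendsto_const_nhds.div_atTop
          (tendsto_atTop_add_const_right _ _ tendsto_natCast_atTop_atTop)
      have := ge_of_tendsto' hl h
      exact sub_eq_zero.1 (abs_nonpos_iff.1 this)
    · intro h n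
      rw [h]
      simp only [sub_self, abs_zero]
      positivity
  rw [← measure_condDensity_eq hf hσ hc ht, ← hi]
  refine tendsto_measure_iInter_atTop (fun n => (measurableSet_le
    ((hm.sub_const t).abs) measurable_const).nullMeasurableSet) ?_ ⟨0, ?_⟩
  · intro m n hmn q hq
    refine le_trans (Set.mem_ofPred_eq ▸ hq) ?_
    gcongr
  -- The shift by 2 makes the widest window t/2, so it sits inside a superlevel set at a positive
  -- level, of finite measure.
  · refine ne_top_of_le_ne_top (bigG_ne_top (μ := μ) hf hσ (half_pos ht)) ?_
    rw [bigG_eq hf hσ]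
    refine measure_mono fun q hq => ?_
    have := abs_le.1 (Set.mem_ofPred_eq ▸ hq)
    clear hq
    simp only [Nat.cast_zero, zero_add] at this
    simp only [Set.mem_ofPred_eq]
    linarith [this.1]

/-- G varies across a window around λ* by at most the mass of the points whose density falls in the
window, and this mass shrinks to zero. -/
lemma bigG_lamStar [IsProbabilityMeasure μ] (hf : Measurable f) (hσ : Measurable σ)
    (hpos : ∀ x, 0 < σ x)
    (hc : ∀ y : ℝ, ContinuousOn (fun t : ℝ => μ {x | t ≤ condDensity f σ x y}) (Set.Ioi 0))
    {ℓ : ℝ} (hℓ : 0 < ℓ) : bigG μ f σ (lamStar μ f σ ℓ) = ENNReal.ofReal ℓ := by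
  set lam := lamStar μ f σ ℓ with hlam
  have hp : 0 < lam := lamStar_pos hf hσ hpos hℓ
  have hnear := tendsto_measure_condDensity_near hf hσ hc hp
  have hsplit : ∀ a b ε : ℝ, b - a ≤ ε → a ≤ lam → lam ≤ b → bigG μ f σ a ≤ bigG μ f σ b +
      (μ.prod volume) {q | |condDensity f σ q.1 q.2 - lam| ≤ ε} := by
    intro a b ε hab ha hb
    rw [bigG_eq hf hσ, bigG_eq hf hσ]
    refine (measure_mono fun q hq => ?_).trans (measure_union_le _ _)
    by_cases h : b ≤ condDensity f σ q.1 q.2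
    · exact Or.inl h
    · right
      have : a ≤ condDensity f σ q.1 q.2 := hq
      simp only [Set.mem_ofPred_eq, abs_le]
      constructor <;> linarith
  apply le_antisymm
  · have h1 : ∀ n : ℕ, bigG μ f σ lam ≤ ENNReal.ofReal ℓ +
        (μ.prod volume) {q | |condDensity f σ q.1 q.2 - lam| ≤ lam / ((n : ℝ) + 2)} := by
      intro n
      have : 0 < lam / ((n : ℝ) + 2) := by positivity
      refine (hsplit lam (lam + lam / ((n : ℝ) + 2)) _ (add_sub_cancel_left _ _).le le_rfl
        (le_add_of_nonneg_right this.le)).trans ?_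
      gcongr
      exact bigG_le_of_lamStar_lt hf hσ hℓ (by linarith)
    simpa using ge_of_tendsto' (hnear.const_add (ENNReal.ofReal ℓ)) h1
  · have h1 : ∀ n : ℕ, ENNReal.ofReal ℓ ≤ bigG μ f σ lam +
        (μ.prod volume) {q | |condDensity f σ q.1 q.2 - lam| ≤ lam / ((n : ℝ) + 2)} := by
      intro n
      have h2 : 0 < lam / ((n : ℝ) + 2) := by positivity
      have h3 : lam / ((n : ℝ) + 2) ≤ lam := div_le_self hp.le (by linarith [n.cast_nonneg (α := ℝ)])
      refine le_trans (lt_bigG_of_lt_lamStar (sub_nonneg.2 h3) (sub_lt_self _ h2)).le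
        (hsplit (lam - lam / ((n : ℝ) + 2)) lam _ (sub_sub_cancel _ _).le (sub_le_self _ h2.le)
          le_rfl)
    simpa using ge_of_tendsto' (hnear.const_add (bigG μ f σ lam)) h1

/-- `G` drops strictly below `ℓ` past `λ*`: each conditional density takes all the values between
`λ*` and its maximum. -/
lemma bigG_lt_of_lamStar_lt [IsProbabilityMeasure μ] (hf : Measurable f) (hσ : Measurable σ)
    (hpos : ∀ x, 0 < σ x)
    (hc : ∀ y : ℝ, ContinuousOn (fun t : ℝ => μ {x | t ≤ condDensity f σ x y}) (Set.Ioi 0))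
    {ℓ t : ℝ} (hℓ : 0 < ℓ) (ht : lamStar μ f σ ℓ < t) : bigG μ f σ t < ENNReal.ofReal ℓ := by
  set lam := lamStar μ f σ ℓ with hlam
  have hp : 0 < lam := lamStar_pos hf hσ hpos hℓ
  have hm := measurable_condDensity hf hσ
  refine lt_of_le_of_ne (bigG_le_of_lamStar_lt hf hσ hℓ ht) fun heq => ?_
  have hG := bigG_lamStar hf hσ hpos hc hℓ
  have hsub : {q : 𝒳 × ℝ | t ≤ condDensity f σ q.1 q.2} ⊆ {q | lam ≤ condDensity f σ q.1 q.2} :=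
    fun q hq => ht.le.trans hq
  have hmt : MeasurableSet {q : 𝒳 × ℝ | t ≤ condDensity f σ q.1 q.2} :=
    measurableSet_le measurable_const hm
  have hml : MeasurableSet {q : 𝒳 × ℝ | lam ≤ condDensity f σ q.1 q.2} :=
    measurableSet_le measurable_const hm
  have hzero : (μ.prod volume) ({q | lam ≤ condDensity f σ q.1 q.2} \
      {q | t ≤ condDensity f σ q.1 q.2}) = 0 := by
    rw [measure_sdiff hsub hmt.nullMeasurableSet, ← bigG_eq hf hσ, ← bigG_eq hf hσ, heq, hG, tsub_self]
    rw [← bigG_eq hf hσ]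
    exact bigG_ne_top hf hσ (hp.trans ht)
  have hae := (Measure.measure_prod_null (hml.diff hmt)).1 hzero
  have hGt : (μ.prod volume) {q : 𝒳 × ℝ | t ≤ condDensity f σ q.1 q.2} ≠ 0 := by
    rw [← bigG_eq hf hσ, heq]
    simpa using hℓ
  refine hGt ((Measure.measure_prod_null hmt).2 ?_)
  filter_upwards [hae] with x hx
  -- If G(t) = ℓ, the band λ* ≤ p < t is null on almost every fibre. A density reaching t decays to
  -- 0, so it takes the value (λ* + t)/2 and spends positive length in the band. Hence almost no
  -- density reaches t, and G(t) = 0 contradicts ℓ > 0.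
  suffices h : Prod.mk x ⁻¹' {q : 𝒳 × ℝ | t ≤ condDensity f σ q.1 q.2} = ∅ by rw [h]; simp
  by_contra hne
  obtain ⟨y, hy⟩ := Set.nonempty_iff_ne_empty.2 hne
  have hcont : Continuous (condDensity f σ x) := continuous_gaussianPDFReal _ _
  have hv : (σ x ^ 2).toNNReal ≠ 0 := by
    have := hpos x
    simp [Real.toNNReal_eq_zero, this.ne']
  obtain ⟨y', hy', hyy⟩ := (((tendsto_gaussianPDFReal_atTop (f x) hv).eventually_lt_const hp).and
    (eventually_ge_atTop y)).exists
  have hopen : IsOpen {y | lam < condDensity f σ x y ∧ condDensity f σ x y < t} :=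
    (isOpen_lt continuous_const hcont).inter (isOpen_lt hcont continuous_const)
  obtain ⟨y₀, -, hy₀⟩ := intermediate_value_Icc' hyy hcont.continuousOn
    (show (lam + t) / 2 ∈ Set.Icc (condDensity f σ x y') (condDensity f σ x y) from
      ⟨by have : condDensity f σ x y' < lam := hy'
          linarith, by have : t ≤ condDensity f σ x y := hy
                       linarith⟩)
  refine (hopen.measure_pos volume ⟨y₀, ?_⟩).ne' (measure_mono_null ?_ hx)
  · simp only [Set.mem_ofPred_eq, hy₀]
    constructor <;> linarith
  · intro z hz
    exact ⟨hz.1.le, not_le.2 hz.2⟩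

/-- The factor 5 anticipates three errors: 3δ for the threshold, δ for the density estimate, δ for
the noise. -/
lemma exists_measure_condDensity_near_le [IsProbabilityMeasure μ] (hf : Measurable f)
    (hσ : Measurable σ)
    (hc : ∀ y : ℝ, ContinuousOn (fun t : ℝ => μ {x | t ≤ condDensity f σ x y}) (Set.Ioi 0))
    {t : ℝ} (ht : 0 < t) {ε : ℝ≥0∞} (hε : 0 < ε) :
    ∃ δ, 0 < δ ∧ 5 * δ < t ∧
      (μ.prod volume) {q | |condDensity f σ q.1 q.2 - t| ≤ 5 * δ} ≤ ε := by
  obtain ⟨n, hn⟩ := ((tendsto_measure_condDensity_near hf hσ hc ht).eventually_le_const hε).exists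
  refine ⟨t / ((n : ℝ) + 2) / 5, by positivity, ?_, ?_⟩
  · rw [mul_div_cancel₀ _ (by norm_num)]
    exact div_lt_self ht (by linarith [n.cast_nonneg (α := ℝ)])
  · rwa [mul_div_cancel₀ _ (by norm_num)]

lemma tendsto_measure_condDensity_tail [IsProbabilityMeasure μ] (hf : Measurable f)
    (hσ : Measurable σ) {t : ℝ} (ht : 0 < t) :
    Tendsto (fun s : ℝ => (μ.prod volume) {q | s < |q.2| ∧ t ≤ condDensity f σ q.1 q.2})
      atTop (𝓝 0) := by
  have hm := measurable_condDensity hf hσ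
  have hi : (⋂ s : ℝ, {q : 𝒳 × ℝ | s < |q.2| ∧ t ≤ condDensity f σ q.1 q.2}) = ∅ := by
    refine Set.eq_empty_of_forall_notMem fun q hq => ?_
    exact lt_irrefl _ (Set.mem_iInter.1 hq |q.2|).1
  have := tendsto_measure_iInter_atTop (μ := μ.prod volume)
    (s := fun s : ℝ => {q : 𝒳 × ℝ | s < |q.2| ∧ t ≤ condDensity f σ q.1 q.2}) (fun s =>
      ((measurableSet_lt measurable_const measurable_snd.abs).inter
        (measurableSet_le measurable_const hm)).nullMeasurableSet)
      (fun a b hab q hq => ⟨hab.trans_lt hq.1, hq.2⟩) ⟨0, ?_⟩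
  · rwa [hi, measure_empty] at this
  · refine ne_top_of_le_ne_top (bigG_ne_top (μ := μ) hf hσ ht) ?_
    rw [bigG_eq hf hσ]
    exact measure_mono fun q hq => hq.2

end Threshold

/-! ### Optimality of the level set and uniqueness up to null sets -/

section Optimality

variable {𝒳 : Type*} [MeasurableSpace 𝒳] {μ : Measure 𝒳} {f σ : 𝒳 → ℝ}

lemma measurablePredictor_levelPredictor (hf : Measurable f) (hσ : Measurable σ) (ℓ : ℝ) :
    MeasurablePredictor (levelPredictor μ f σ ℓ) :=
  measurableSet_le measurable_const (measurable_condDensity hf hσ)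

lemma superlevel_ofReal_eq {𝒳 : Type*} (f σ : 𝒳 → ℝ) (t : ℝ) :
    {q : 𝒳 × ℝ | ENNReal.ofReal t ≤ ENNReal.ofReal (condDensity f σ q.1 q.2)} =
      {q | t ≤ condDensity f σ q.1 q.2} := by
  ext q
  simp [ENNReal.ofReal_le_ofReal_iff (condDensity_nonneg f σ q.1 q.2)]

/-- The level set uses the whole budget, G(λ*) = ℓ, so every competitor is at most as large and
Neyman-Pearson applies. -/
theorem isOptimalPredictor_levelPredictor [IsProbabilityMeasure μ] (hf : Measurable f)
    (hσ : Measurable σ) (hpos : ∀ x, 0 < σ x)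
    (hc : ∀ y : ℝ, ContinuousOn (fun t : ℝ => μ {x | t ≤ condDensity f σ x y}) (Set.Ioi 0))
    {ℓ : ℝ} (hℓ : 0 < ℓ) : IsOptimalPredictor μ f σ ℓ (levelPredictor μ f σ ℓ) := by
  have hmp := measurablePredictor_levelPredictor (μ := μ) hf hσ ℓ
  have hlen : expLength μ (levelPredictor μ f σ ℓ) = ENNReal.ofReal ℓ := by
    rw [expLength_eq hmp, ← bigG_lamStar hf hσ hpos hc hℓ, bigG_eq hf hσ]
    rfl
  refine ⟨hmp, hlen.le, fun Γ hΓ hΓℓ => ?_⟩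
  rw [expLength_eq hmp] at hlen
  rw [expLength_eq hΓ, ← hlen] at hΓℓ
  rw [errorRate, errorRate, obsLaw_eq_withDensity hf hσ hpos]
  have h := withDensity_compl_superlevel_le (W := μ.prod volume) (c := ENNReal.ofReal (lamStar μ f σ ℓ))
    (measurable_condDensity hf hσ).ennreal_ofReal hΓ
  rw [superlevel_ofReal_eq] at h
  exact h (hlen ▸ ENNReal.ofReal_ne_top) hΓℓ

theorem measure_symmDiff_levelPredictor_eq_zero [IsProbabilityMeasure μ] (hf : Measurable f)
    (hσ : Measurable σ) (hpos : ∀ x, 0 < σ x)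
    (hc : ∀ y : ℝ, ContinuousOn (fun t : ℝ => μ {x | t ≤ condDensity f σ x y}) (Set.Ioi 0))
    {ℓ : ℝ} (hℓ : 0 < ℓ) {Γs : 𝒳 → Set ℝ} (hΓs : IsOptimalPredictor μ f σ ℓ Γs) :
    ∀ᵐ x ∂μ, volume (Γs x ∆ levelPredictor μ f σ ℓ x) = 0 := by
  have hmp := measurablePredictor_levelPredictor (μ := μ) hf hσ ℓ
  have hlv := isOptimalPredictor_levelPredictor hf hσ hpos hc hℓ
  have hlen := bigG_lamStar hf hσ hpos hc hℓ
  rw [bigG_eq hf hσ] at hlen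
  have hdens := obsLaw_eq_withDensity (μ := μ) hf hσ hpos
  have hfinite : IsFiniteMeasure ((μ.prod volume).withDensity
      fun q => ENNReal.ofReal (condDensity f σ q.1 q.2)) := by
    rw [← hdens]
    have := isProbabilityMeasure_obsLaw (μ := μ) hf hσ
    infer_instance
  have h := measure_symmDiff_superlevel_eq_zero (W := μ.prod volume)
    (c := ENNReal.ofReal (lamStar μ f σ ℓ))
    (measurable_condDensity hf hσ).ennreal_ofReal hΓs.1 ENNReal.ofReal_ne_top
  rw [superlevel_ofReal_eq, hlen] at h
  have h2 := h ENNReal.ofReal_ne_top ((expLength_eq hΓs.1).symm.trans_le hΓs.2.1) ?_ ?_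
  · exact (Measure.measure_prod_null (hΓs.1.symmDiff hmp)).1 h2
  · refine measure_mono_null (fun q hq => ?_)
      (measure_condDensity_eq hf hσ hc (lamStar_pos (μ := μ) hf hσ hpos hℓ))
    exact (ENNReal.ofReal_eq_ofReal_iff (condDensity_nonneg f σ q.1 q.2)
      (lamStar_pos (μ := μ) hf hσ hpos hℓ).le).1 hq
  · rw [← hdens]
    exact hΓs.2.2 _ hmp hlv.2.1

end Optimality

/-! ### Risk differences bounded by symmetric differences -/

section RiskComparison

variable {𝒳 : Type*} [MeasurableSpace 𝒳] {μ : Measure 𝒳} {f σ : 𝒳 → ℝ}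

lemma lintegral_volume_symmDiff [SFinite μ] {Γ₁ Γ₂ : 𝒳 → Set ℝ} (h₁ : MeasurablePredictor Γ₁)
    (h₂ : MeasurablePredictor Γ₂) :
    ∫⁻ x, volume (Γ₁ x ∆ Γ₂ x) ∂μ =
      (μ.prod volume) ({q | q.2 ∈ Γ₁ q.1} ∆ {q | q.2 ∈ Γ₂ q.1}) := by
  rw [Measure.prod_apply (h₁.symmDiff h₂)]
  rfl

/-- One C bounds the density, hence the change of error rate; the other bounds `lam`, hence the
weighted change of length. -/
lemma risk_le_risk_add [SFinite μ] (hf : Measurable f) (hσ : Measurable σ) (hpos : ∀ x, 0 < σ x)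
    {C lam : ℝ} (hlam : lam ≤ C) (hC : ∀ x y, condDensity f σ x y ≤ C)
    {Γ₁ Γ₂ : 𝒳 → Set ℝ} (h₁ : MeasurablePredictor Γ₁) (h₂ : MeasurablePredictor Γ₂) :
    risk μ f σ lam Γ₁ ≤
      risk μ f σ lam Γ₂ + ENNReal.ofReal (2 * C) * ∫⁻ x, volume (Γ₁ x ∆ Γ₂ x) ∂μ := by
  set K := ∫⁻ x, volume (Γ₁ x ∆ Γ₂ x) ∂μ with hK
  rw [lintegral_volume_symmDiff h₁ h₂] at hK
  have hsd : MeasurableSet ({q : 𝒳 × ℝ | q.2 ∈ Γ₁ q.1} ∆ {q | q.2 ∈ Γ₂ q.1}) := h₁.symmDiff h₂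
  have herr : errorRate μ f σ Γ₁ ≤ errorRate μ f σ Γ₂ + ENNReal.ofReal C * K := by
    have h3 : obsLaw μ f σ ({q : 𝒳 × ℝ | q.2 ∈ Γ₁ q.1} ∆ {q | q.2 ∈ Γ₂ q.1}) ≤
        ENNReal.ofReal C * K := by
      rw [obsLaw_eq_withDensity hf hσ hpos, withDensity_apply _ hsd, hK, ← setLIntegral_const]
      exact setLIntegral_mono' hsd fun q _ => ENNReal.ofReal_le_ofReal (hC q.1 q.2)
    refine le_trans ?_ (add_le_add_right h3 _)
    refine (measure_mono fun q hq => ?_).trans (measure_union_le _ _)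
    by_cases h : q.2 ∈ Γ₂ q.1
    · exact Or.inr (Or.inr ⟨h, hq⟩)
    · exact Or.inl h
  have hlen : expLength μ Γ₁ ≤ expLength μ Γ₂ + K := by
    rw [expLength_eq h₁, expLength_eq h₂, hK]
    refine (measure_mono fun q hq => ?_).trans (measure_union_le _ _)
    by_cases h : q.2 ∈ Γ₂ q.1
    · exact Or.inl h
    · exact Or.inr (Or.inl ⟨hq, h⟩)
  -- A point of the space is needed to know that C is nonnegative.
  rcases isEmpty_or_nonempty 𝒳 with hE | ⟨⟨x₀⟩⟩
  · have : μ = 0 := Measure.eq_zero_of_isEmpty μ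
    simp [risk, this, errorRate, expLength, obsLaw]
  have hC0 : 0 ≤ C := (condDensity_nonneg f σ x₀ 0).trans (hC x₀ 0)
  calc risk μ f σ lam Γ₁ ≤ (errorRate μ f σ Γ₂ + ENNReal.ofReal C * K) +
        ENNReal.ofReal lam * (expLength μ Γ₂ + K) := by
        unfold risk
        gcongr
    _ ≤ (errorRate μ f σ Γ₂ + ENNReal.ofReal C * K) +
        (ENNReal.ofReal lam * expLength μ Γ₂ + ENNReal.ofReal C * K) := by
        rw [mul_add]
        gcongr
    _ = risk μ f σ lam Γ₂ + ENNReal.ofReal (2 * C) * K := by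
        rw [two_mul, ENNReal.ofReal_add hC0 hC0, risk]
        ring

lemma toENNReal_coe_sub_le {a b K : ℝ≥0∞} (h : a ≤ b + K) :
    ((a : EReal) - (b : EReal)).toENNReal ≤ K := by
  rw [EReal.toENNReal_sub (EReal.coe_ennreal_nonneg b), EReal.toENNReal_coe, EReal.toENNReal_coe]
  exact tsub_le_iff_left.2 h

lemma toENNReal_neg_coe_sub_le {a b K : ℝ≥0∞} (hb : b ≠ ∞) (h : b ≤ a + K) :
    (-((a : EReal) - (b : EReal))).toENNReal ≤ K := by
  rw [EReal.neg_sub (Or.inl (EReal.coe_ennreal_ne_bot _))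
    (Or.inr (by simpa using hb)), add_comm, ← sub_eq_add_neg]
  exact toENNReal_coe_sub_le h

lemma eexpect_le {Ω : Type*} [MeasurableSpace Ω] {P : Measure Ω} {Z : Ω → EReal} {K : Ω → ℝ≥0∞}
    (h : ∀ ω, (Z ω).toENNReal ≤ K ω) : eexpect P Z ≤ ((∫⁻ ω, K ω ∂P : ℝ≥0∞) : EReal) := by
  unfold eexpect
  calc _ ≤ ((∫⁻ ω, (Z ω).toENNReal ∂P : ℝ≥0∞) : EReal) - 0 :=
        EReal.sub_le_sub le_rfl (EReal.coe_ennreal_nonneg _)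
    _ ≤ _ := by
        rw [sub_zero, EReal.coe_ennreal_le_coe_ennreal_iff]
        exact lintegral_mono h

lemma neg_le_eexpect {Ω : Type*} [MeasurableSpace Ω] {P : Measure Ω} {Z : Ω → EReal}
    {K : Ω → ℝ≥0∞} (h : ∀ ω, (-Z ω).toENNReal ≤ K ω) :
    -((∫⁻ ω, K ω ∂P : ℝ≥0∞) : EReal) ≤ eexpect P Z := by
  unfold eexpect
  rw [← zero_sub]
  refine EReal.sub_le_sub (EReal.coe_ennreal_nonneg _) ?_
  rw [EReal.coe_ennreal_le_coe_ennreal_iff]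
  exact lintegral_mono h

end RiskComparison

/-! ### Measuring the length of an interval on a grid -/

section Grid

/-- On each cell the sample term and the integral both lie between the endpoint values times the
cell length; the gaps telescope. -/
lemma abs_grid_sum_sub_integral_le_of_monotone {M : ℕ} (hM : 0 < M) {s : ℝ} (hs : 0 ≤ s)
    {grid : Fin M → ℝ} (hg : IsGrid s grid) {φ : ℝ → ℝ} (hφ : Monotone φ) :
    |2 * s / M * ∑ k, φ (grid k) - ∫ y in (-s)..s, φ y| ≤ 2 * s / M * (φ s - φ (-s)) := by
  have hM' : (0 : ℝ) < M := by exact_mod_cast hM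
  set c : ℕ → ℝ := fun j => -s + 2 * s * j / M with hc
  set δ := 2 * s / M with hδ
  have hδ0 : 0 ≤ δ := by positivity
  have hstep : ∀ j, c (j + 1) - c j = δ := by
    intro j
    simp only [hc, hδ]
    push_cast
    ring
  have hc0 : c 0 = -s := by simp [hc]
  have hcM : c M = s := by simp only [hc]; field_simp; ring
  have hint : ∀ a b, IntervalIntegrable φ volume a b := fun a b => hφ.intervalIntegrable
  have hsum := intervalIntegral.sum_integral_adjacent_intervals (f := φ) (μ := volume) (a := c)
    (n := M) fun k _ => hint _ _
  rw [hc0, hcM] at hsum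
  have htel := Finset.sum_range_sub (fun j => φ (c j)) M
  simp only [hc0, hcM] at htel
  rw [← hsum, ← htel, ← Fin.sum_univ_eq_sum_range (fun j => ∫ y in c j..c (j + 1), φ y),
    ← Fin.sum_univ_eq_sum_range (fun j => φ (c (j + 1)) - φ (c j)), Finset.mul_sum, Finset.mul_sum,
    ← Finset.sum_sub_distrib]
  refine (Finset.abs_sum_le_sum_abs _ _).trans (Finset.sum_le_sum fun k _ => ?_)
  have hle : c k ≤ c (k + 1) := by linarith [hstep k]
  obtain ⟨hg1, hg2⟩ : c k ≤ grid k ∧ grid k ≤ c (k + 1) := by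
    have := hg k
    simp only [hc]
    push_cast
    exact this
  have hi1 : δ * φ (c k) ≤ ∫ y in c k..c (k + 1), φ y := by
    have := intervalIntegral.integral_mono_on hle (intervalIntegrable_const (c := φ (c k))) (hint _ _)
      fun y hy => hφ hy.1
    simpa [hstep] using this
  have hi2 : ∫ y in c k..c (k + 1), φ y ≤ δ * φ (c (k + 1)) := by
    have := intervalIntegral.integral_mono_on hle (hint _ _) (intervalIntegrable_const (c := φ (c (k + 1))))
      fun y hy => hφ hy.2
    simpa [hstep] using this
  have h1 := mul_le_mul_of_nonneg_left (hφ hg1) hδ0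
  have h2 := mul_le_mul_of_nonneg_left (hφ hg2) hδ0
  rw [abs_le]
  constructor <;> linarith

lemma abs_grid_sum_sub_volume_le {M : ℕ} (hM : 0 < M) {s : ℝ} (hs : 0 ≤ s)
    {grid : Fin M → ℝ} (hg : IsGrid s grid) {S : Set ℝ} (hS : S.OrdConnected) :
    |2 * s / M * ∑ k, S.indicator 1 (grid k) - volume.real (S ∩ Set.Icc (-s) s)| ≤ 4 * s / M := by
  classical
  -- The indicator of an interval is the difference of two increasing indicators, of its upper
  -- closure U and of U \ S; each contributes an error of 2s/M.
  set U : Set ℝ := {y | ∃ w ∈ S, w ≤ y} with hU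
  have hSU : S ⊆ U := fun y hy => ⟨y, hy, le_rfl⟩
  have hup : ∀ {a b : ℝ}, a ≤ b → a ∈ U → b ∈ U := fun hab ⟨w, hw, h⟩ => ⟨w, hw, h.trans hab⟩
  have hUm : Monotone (U.indicator (1 : ℝ → ℝ)) := by
    intro a b hab
    by_cases ha : a ∈ U
    · have hb : b ∈ U := hup hab ha
      simp [ha, hb]
    · rw [Set.indicator_of_notMem ha]
      exact Set.indicator_nonneg (fun _ _ => zero_le_one) _
  have hVm : Monotone ((U \ S).indicator (1 : ℝ → ℝ)) := by
    intro a b hab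
    by_cases ha : a ∈ U \ S
    · have hb : b ∈ U \ S := by
        refine ⟨hup hab ha.1, fun hbS => ha.2 ?_⟩
        obtain ⟨w, hw, hwa⟩ := ha.1
        exact hS.out hw hbS ⟨hwa, hab⟩
      simp [ha, hb]
    · rw [Set.indicator_of_notMem ha]
      exact Set.indicator_nonneg (fun _ _ => zero_le_one) _
  have hdiff : ∀ y, S.indicator (1 : ℝ → ℝ) y = U.indicator 1 y - (U \ S).indicator 1 y := by
    intro y
    by_cases h1 : y ∈ S
    · simp [h1, hSU h1]
    · by_cases h2 : y ∈ U <;> simp [h1, h2]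
  have hvol : volume.real (S ∩ Set.Icc (-s) s) =
      (∫ y in (-s)..s, U.indicator 1 y) - ∫ y in (-s)..s, (U \ S).indicator 1 y := by
    rw [← intervalIntegral.integral_sub hUm.intervalIntegrable hVm.intervalIntegrable]
    simp_rw [← hdiff]
    rw [intervalIntegral.integral_of_le (by linarith), ← integral_Icc_eq_integral_Ioc,
      integral_indicator_one hS.measurableSet, measureReal_restrict_apply hS.measurableSet]
  have hb : ∀ T : Set ℝ, T.indicator (1 : ℝ → ℝ) s - T.indicator 1 (-s) ≤ 1 := by
    intro T
    have h1 : T.indicator (1 : ℝ → ℝ) s ≤ 1 := Set.indicator_le_self' (by simp) s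
    have h2 : 0 ≤ T.indicator (1 : ℝ → ℝ) (-s) := Set.indicator_nonneg (fun _ _ => zero_le_one) _
    linarith
  have hδ0 : 0 ≤ 2 * s / M := by positivity
  have e1 := (abs_grid_sum_sub_integral_le_of_monotone hM hs hg hUm).trans
    (mul_le_mul_of_nonneg_left (hb U) hδ0)
  have e2 := (abs_grid_sum_sub_integral_le_of_monotone hM hs hg hVm).trans
    (mul_le_mul_of_nonneg_left (hb (U \ S)) hδ0)
  simp_rw [hdiff, hvol, Finset.sum_sub_distrib]
  have h4 : 4 * s / M = 2 * s / M + 2 * s / M := by ring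
  rw [abs_le] at *
  constructor <;> linarith [e1.1, e1.2, e2.1, e2.2]

end Grid

/-! ### Chebyshev bounds for empirical means -/

section Concentration

lemma measure_mean_deviation_le {𝒵 : Type*} [MeasurableSpace 𝒵] (β : Measure 𝒵)
    [IsProbabilityMeasure β] {h : 𝒵 → ℝ} (hm : Measurable h) {b : ℝ} (h0 : ∀ z, h z ∈ Set.Icc 0 b)
    {N : ℕ} (hN : 0 < N) {κ : ℝ} (hκ : 0 < κ) :
    (Measure.pi fun _ : Fin N => β) {w | κ ≤ |(N : ℝ)⁻¹ * ∑ i, h (w i) - ∫ z, h z ∂β|} ≤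
      ENNReal.ofReal (b ^ 2 / (N * κ ^ 2)) := by
  have hN' : (0 : ℝ) < N := by exact_mod_cast hN
  have hL : MemLp h 2 β := memLp_of_bounded (Eventually.of_forall h0) hm.aestronglyMeasurable 2
  have hLi : ∀ i : Fin N, MemLp (fun w : Fin N → 𝒵 => h (w i)) 2 (Measure.pi fun _ : Fin N => β) :=
    fun i => hL.comp_measurePreserving (measurePreserving_eval _ i)
  have hS : MemLp (∑ i : Fin N, fun w : Fin N → 𝒵 => h (w i)) 2 (Measure.pi fun _ : Fin N => β) :=
    memLp_finsetSum' _ fun i _ => hLi i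
  have hE : ∫ w, (∑ i : Fin N, fun w : Fin N → 𝒵 => h (w i)) w ∂(Measure.pi fun _ : Fin N => β) =
      N * ∫ z, h z ∂β := by
    simp only [Finset.sum_apply]
    rw [integral_finsetSum _ fun i _ => (hLi i).integrable one_le_two]
    have : ∀ i : Fin N, ∫ w, h (w i) ∂(Measure.pi fun _ : Fin N => β) = ∫ z, h z ∂β :=
      fun i => integral_comp_eval (μ := fun _ : Fin N => β) hm.aestronglyMeasurable
    simp [this]
  have hV : Var[∑ i : Fin N, fun w : Fin N → 𝒵 => h (w i); Measure.pi fun _ : Fin N => β] ≤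
      N * b ^ 2 := by
    rw [variance_sum_pi (μ := fun _ : Fin N => β) (X := fun _ => h) fun _ => hL]
    have := variance_le_sq_of_bounded (Eventually.of_forall h0) hm.aemeasurable (μ := β)
    simp only [Finset.sum_const, Finset.card_univ, Fintype.card_fin, nsmul_eq_mul]
    gcongr
    refine this.trans ?_
    nlinarith [sq_nonneg b]
  refine le_trans (measure_mono fun w hw => ?_)
    ((meas_ge_le_variance_div_sq hS (c := N * κ) (by positivity)).trans ?_)
  · simp only [Set.mem_ofPred_eq] at hw ⊢
    rw [hE]
    calc (N : ℝ) * κ ≤ N * |(N : ℝ)⁻¹ * ∑ i, h (w i) - ∫ z, h z ∂β| := by gcongr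
      _ = _ := by
        rw [← abs_of_pos hN', ← abs_mul, abs_of_pos hN', mul_sub, mul_inv_cancel_left₀ hN'.ne']
        simp
  · apply ENNReal.ofReal_le_ofReal
    calc _ ≤ N * b ^ 2 / (N * κ) ^ 2 := by gcongr
      _ = _ := by field_simp

/-- Independent samples of X and of ζ, zipped together, form an i.i.d. sample of pairs. -/
lemma measure_mean_deviation_prod_le {𝒳 : Type*} [MeasurableSpace 𝒳] (μ : Measure 𝒳)
    [IsProbabilityMeasure μ] (ν : Measure ℝ) [IsProbabilityMeasure ν] {h : 𝒳 × ℝ → ℝ}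
    (hm : Measurable h) {b : ℝ} (h0 : ∀ z, h z ∈ Set.Icc 0 b) {N : ℕ} (hN : 0 < N) {κ : ℝ}
    (hκ : 0 < κ) :
    ((Measure.pi fun _ : Fin N => μ).prod (Measure.pi fun _ : Fin N => ν))
        {D | κ ≤ |(N : ℝ)⁻¹ * ∑ i, h (D.1 i, D.2 i) - ∫ z, h z ∂(μ.prod ν)|} ≤
      ENNReal.ofReal (b ^ 2 / (N * κ ^ 2)) := by
  have hp := measurePreserving_arrowProdEquivProdArrow 𝒳 ℝ (Fin N) (fun _ => μ) (fun _ => ν)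
  rw [← hp.measure_preimage_equiv]
  exact measure_mean_deviation_le (μ.prod ν) hm h0 hN hκ

end Concentration

/-! ### Plug-in density and empirical threshold -/

section PlugIn

/-- For s < 1 the last two indicators can be active together, but the sum is still positive. -/
lemma threshold_pos {s : ℝ} (hs : 0 < s) (v : ℝ) : 0 < threshold s v := by
  have hs' : 0 < s⁻¹ := inv_pos.2 hs
  unfold threshold
  split_ifs <;> first | linarith | skip
  all_goals exfalso; grind

lemma measurable_threshold (s : ℝ) : Measurable (threshold s) := by
  unfold threshold
  refine Measurable.add (Measurable.add ?_ ?_) ?_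
  · exact Measurable.ite ((measurableSet_le measurable_const measurable_id).inter
      (measurableSet_le measurable_id measurable_const)) measurable_id measurable_const
  · exact Measurable.ite (measurableSet_lt measurable_id measurable_const) measurable_const
      measurable_const
  · exact Measurable.ite (measurableSet_lt measurable_const measurable_id) measurable_const
      measurable_const

lemma volume_gaussianPDFReal_eq (m c : ℝ) {v : NNReal} (hv : v ≠ 0) :
    volume {y | gaussianPDFReal m v y = c} = 0 := by
  rcases Set.eq_empty_or_nonempty {y | gaussianPDFReal m v y = c} with h | ⟨y₀, hy₀⟩
  · simp [h]
  have hv' : 0 < (v : ℝ) := by positivity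
  have hsub : {y | gaussianPDFReal m v y = c} ⊆ {y₀, 2 * m - y₀} := by
    intro y hy
    have h1 : gaussianPDFReal m v y = gaussianPDFReal m v y₀ := Eq.trans (b := c) hy hy₀.symm
    simp only [gaussianPDFReal] at h1
    have h2 := Real.exp_injective (mul_left_cancel₀ (by positivity) h1)
    have h3 : (y - m) ^ 2 = (y₀ - m) ^ 2 := by
      field_simp at h2
      linarith
    rcases sq_eq_sq_iff_eq_or_eq_neg.1 h3 with h | h
    · left; linarith
    · right
      simp only [Set.mem_singleton_iff]
      linarith
  exact ((Set.finite_singleton _).insert _ |>.subset hsub).measure_zero _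

variable {𝒳 : Type*} {s : ℝ} {a b : 𝒳 → ℝ}

lemma plugInDensity_eq_of_le (x : 𝒳) (z : ℝ) {y : ℝ} (hy : |y| ≤ s) :
    plugInDensity s a b x z y =
      gaussianPDFReal (a x) (threshold s (b x ^ 2)).toNNReal y + z := if_pos hy

lemma plugInDensity_eq_zero (x : 𝒳) (z : ℝ) {y : ℝ} (hy : s < |y|) :
    plugInDensity s a b x z y = 0 := if_neg (not_le.2 hy)

lemma abs_le_of_plugInDensity_pos {x : 𝒳} {z y : ℝ} (h : 0 < plugInDensity s a b x z y) :
    |y| ≤ s := by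
  by_contra hy
  rw [plugInDensity_eq_zero x z (not_le.1 hy)] at h
  exact lt_irrefl _ h

lemma measurable_plugInDensity [MeasurableSpace 𝒳] (ha : Measurable a) (hb : Measurable b) :
    Measurable fun q : (𝒳 × ℝ) × ℝ => plugInDensity s a b q.1.1 q.1.2 q.2 := by
  unfold plugInDensity
  refine Measurable.ite (measurableSet_le measurable_snd.abs measurable_const) ?_ measurable_const
  refine Measurable.add ?_ (by fun_prop)
  exact measurable_gaussianPDFReal_comp (ha.comp (by fun_prop))
    ((measurable_threshold s).comp ((hb.comp (by fun_prop)).pow_const 2)) measurable_snd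

lemma measurablePredictor_superlevel_plugInDensity [MeasurableSpace 𝒳] (ha : Measurable a)
    (hb : Measurable b) (r : ℝ) :
    MeasurablePredictor fun w : 𝒳 × ℝ => {y | r ≤ plugInDensity s a b w.1 w.2 y} :=
  measurableSet_le measurable_const (measurable_plugInDensity ha hb)

/-- The noise does not depend on y, so it only shifts the level of the Gaussian; t ≥ 0 excludes |y|
> s, where the plug-in density vanishes. -/
lemma superlevel_plugInDensity_eq {t : ℝ} (ht : 0 ≤ t) (x : 𝒳) (z : ℝ) :
    {y | t < plugInDensity s a b x z y} =
      {y | t - z < gaussianPDFReal (a x) (threshold s (b x ^ 2)).toNNReal y} ∩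
        Set.Icc (-s) s := by
  ext y
  simp only [Set.mem_ofPred_eq, Set.mem_inter_iff, Set.mem_Icc, ← abs_le]
  by_cases hy : |y| ≤ s
  · rw [plugInDensity_eq_of_le x z hy, sub_lt_iff_lt_add]
    simp [hy]
  · rw [plugInDensity_eq_zero x z (not_le.1 hy)]
    simp [hy, ht]

lemma IsGrid.mem_Icc {M : ℕ} (hs : 0 ≤ s) {grid : Fin M → ℝ} (hg : IsGrid s grid) (k : Fin M) :
    grid k ∈ Set.Icc (-s) s := by
  have hM : (0 : ℝ) < M := by exact_mod_cast k.pos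
  have hk : ((k : ℕ) : ℝ) + 1 ≤ M := by exact_mod_cast k.2
  obtain ⟨h1, h2⟩ := hg k
  constructor
  · refine le_trans ?_ h1
    have : 0 ≤ 2 * s * k / M := by positivity
    linarith
  · refine h2.trans ?_
    have : 2 * s * (k + 1) / M ≤ 2 * s := by
      rw [div_le_iff₀ hM]
      gcongr
    linarith

/-- Proportion of the grid where the plug-in density exceeds `t`, scaled by the length `2 s`. -/
noncomputable def gridLength {M : ℕ} (s : ℝ) (grid : Fin M → ℝ) (a b : 𝒳 → ℝ) (t : ℝ) (w : 𝒳 × ℝ) : ℝ :=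
  2 * s / M * ∑ k : Fin M, if t < plugInDensity s a b w.1 w.2 (grid k) then 1 else 0

lemma abs_gridLength_sub_volume_le {M : ℕ} (hM : 0 < M) (hs : 0 ≤ s) {grid : Fin M → ℝ}
    (hg : IsGrid s grid) {t : ℝ} (ht : 0 ≤ t) (w : 𝒳 × ℝ) :
    |gridLength s grid a b t w - volume.real {y | t < plugInDensity s a b w.1 w.2 y}| ≤
      4 * s / M := by
  have h := abs_grid_sum_sub_volume_le hM hs hg
    (ordConnected_gaussianPDFReal (a w.1) (threshold s (b w.1 ^ 2)).toNNReal (t - w.2))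
  have hk : ∀ k, (if t < plugInDensity s a b w.1 w.2 (grid k) then (1 : ℝ) else 0) =
      {y | t - w.2 < gaussianPDFReal (a w.1) (threshold s (b w.1 ^ 2)).toNNReal y}.indicator 1
        (grid k) := by
    intro k
    have : grid k ∈ {y | t < plugInDensity s a b w.1 w.2 y} ↔
        grid k ∈ {y | t - w.2 < gaussianPDFReal (a w.1) (threshold s (b w.1 ^ 2)).toNNReal y} := by
      rw [superlevel_plugInDensity_eq ht]
      exact and_iff_left (hg.mem_Icc hs k)
    by_cases h1 : t < plugInDensity s a b w.1 w.2 (grid k)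
    · rw [if_pos h1, Set.indicator_of_mem (this.1 h1)]
      rfl
    · rw [if_neg h1, Set.indicator_of_notMem fun h2 => h1 (this.2 h2)]
  rw [superlevel_plugInDensity_eq ht, gridLength]
  simp_rw [hk]
  exact h

lemma gridLength_mem_Icc {M : ℕ} (hs : 0 ≤ s) (grid : Fin M → ℝ) (t : ℝ) (w : 𝒳 × ℝ) :
    gridLength s grid a b t w ∈ Set.Icc 0 (2 * s) := by
  have h0 : (0 : ℝ) ≤ ∑ k : Fin M, if t < plugInDensity s a b w.1 w.2 (grid k) then (1 : ℝ) else 0 :=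
    Finset.sum_nonneg fun k _ => by split_ifs <;> norm_num
  have h1 : (∑ k : Fin M, if t < plugInDensity s a b w.1 w.2 (grid k) then (1 : ℝ) else 0) ≤ M := by
    refine (Finset.sum_le_sum fun k _ => (by split_ifs <;> norm_num :
      (if t < plugInDensity s a b w.1 w.2 (grid k) then (1 : ℝ) else 0) ≤ 1)).trans ?_
    simp
  refine ⟨mul_nonneg (by positivity) h0, ?_⟩
  rcases Nat.eq_zero_or_pos M with rfl | hM
  · simp [gridLength, hs]
  have hM' : (0 : ℝ) < M := by exact_mod_cast hM
  calc gridLength s grid a b t w ≤ 2 * s / M * M := mul_le_mul_of_nonneg_left h1 (by positivity)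
    _ = 2 * s := by field_simp

lemma measurable_gridLength [MeasurableSpace 𝒳] (ha : Measurable a) (hb : Measurable b) {M : ℕ}
    (grid : Fin M → ℝ) (t : ℝ) : Measurable (gridLength s grid a b t) := by
  unfold gridLength
  refine Measurable.const_mul (Finset.measurable_sum _ fun k _ => ?_) _
  refine Measurable.ite (measurableSet_lt measurable_const ?_) measurable_const measurable_const
  exact (measurable_plugInDensity ha hb).comp
    (by fun_prop : Measurable fun w : 𝒳 × ℝ => (w, grid k))

lemma empG_eq_mean {M N : ℕ} (grid : Fin M → ℝ) (xs : Fin N → 𝒳) (zs : Fin N → ℝ) (t : ℝ) :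
    empG s grid a b xs zs t = (N : ℝ)⁻¹ * ∑ i, gridLength s grid a b t (xs i, zs i) := by
  unfold empG gridLength
  rw [Finset.sum_comm, ← Finset.mul_sum, ← mul_assoc]
  congr 1
  ring

lemma empG_antitone {M N : ℕ} (hs : 0 ≤ s) (grid : Fin M → ℝ) (xs : Fin N → 𝒳)
    (zs : Fin N → ℝ) : Antitone (empG s grid a b xs zs) := by
  intro t t' htt
  unfold empG
  refine mul_le_mul_of_nonneg_left (Finset.sum_le_sum fun k _ => Finset.sum_le_sum fun i _ => ?_)
    (by positivity)
  split_ifs with h1 h2 <;> linarith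

lemma genInv_empG_nonempty {M N : ℕ} (grid : Fin M → ℝ) (xs : Fin N → 𝒳)
    (zs : Fin N → ℝ) {ℓ : ℝ} (hℓ : 0 < ℓ) :
    {t : ℝ | 0 ≤ t ∧ empG s grid a b xs zs t ≤ ℓ}.Nonempty := by
  have h : ∀ᶠ t : ℝ in atTop, ∀ (k : Fin M) (i : Fin N),
      plugInDensity s a b (xs i) (zs i) (grid k) ≤ t := by
    simp only [eventually_all]
    exact fun k i => eventually_ge_atTop _
  obtain ⟨t, ht, ht0⟩ := (h.and (eventually_ge_atTop 0)).exists
  refine ⟨t, ht0, ?_⟩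
  have : empG s grid a b xs zs t = 0 := by
    unfold empG
    simp [fun k i => not_lt.2 (ht k i)]
  rw [this]
  exact hℓ.le

lemma lt_empG_of_lt_genInv {M N : ℕ} {grid : Fin M → ℝ} {xs : Fin N → 𝒳}
    {zs : Fin N → ℝ} {ℓ t : ℝ} (h0 : 0 ≤ t) (ht : t < genInv (empG s grid a b xs zs) ℓ) :
    ℓ < empG s grid a b xs zs t := by
  by_contra h
  exact absurd (csInf_le (genInv_bddBelow _ _) ⟨h0, not_lt.1 h⟩) (not_le.2 ht)

lemma empG_le_of_genInv_lt {M N : ℕ} (hs : 0 ≤ s) {grid : Fin M → ℝ} {xs : Fin N → 𝒳}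
    {zs : Fin N → ℝ} {ℓ t : ℝ} (hℓ : 0 < ℓ) (ht : genInv (empG s grid a b xs zs) ℓ < t) :
    empG s grid a b xs zs t ≤ ℓ := by
  obtain ⟨r, hr, hrt⟩ := exists_lt_of_csInf_lt (genInv_empG_nonempty grid xs zs hℓ) ht
  exact (empG_antitone hs grid xs zs hrt.le).trans hr.2

/-- All sampled densities are positive, so Ĝ equals 2s > ℓ at small t > 0. A threshold 0 would make
the predictor contain all |y| > s, of infinite length. -/
lemma genInv_empG_pos {M N : ℕ} (hM : 0 < M) (hN : 0 < N) (hs : 0 < s) {grid : Fin M → ℝ}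
    (hg : IsGrid s grid) (xs : Fin N → 𝒳) {zs : Fin N → ℝ} (hz : ∀ i, 0 ≤ zs i) {ℓ : ℝ}
    (hℓ : 0 < ℓ) (hℓs : ℓ < 2 * s) : 0 < genInv (empG s grid a b xs zs) ℓ := by
  have hpos : ∀ k i, 0 < plugInDensity s a b (xs i) (zs i) (grid k) := by
    intro k i
    rw [plugInDensity_eq_of_le _ _ (abs_le.2 (hg.mem_Icc hs.le k))]
    have := gaussianPDFReal_pos (a (xs i)) (threshold s (b (xs i) ^ 2)).toNNReal (grid k)
      (Real.toNNReal_pos.2 (threshold_pos hs _)).ne'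
    linarith [hz i]
  have h : ∀ᶠ t : ℝ in 𝓝[>] 0, ∀ (k : Fin M) (i : Fin N),
      t < plugInDensity s a b (xs i) (zs i) (grid k) := by
    simp only [eventually_all]
    exact fun k i => nhdsWithin_le_nhds (eventually_lt_nhds (hpos k i))
  obtain ⟨t, ht, ht0⟩ := (h.and self_mem_nhdsWithin).exists
  have hM' : (0 : ℝ) < M := by exact_mod_cast hM
  have hN' : (0 : ℝ) < N := by exact_mod_cast hN
  have hGt : empG s grid a b xs zs t = 2 * s := by
    unfold empG
    simp only [ht, if_true, Finset.sum_const, Finset.card_univ, Fintype.card_fin, nsmul_eq_mul,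
      mul_one]
    field_simp
  refine (Set.mem_Ioi.1 ht0).trans_le (not_lt.1 fun h' => ?_)
  have := empG_le_of_genInv_lt hs.le hℓ h'
  linarith

end PlugIn

/-! ### Removing the uniform noise -/

section UnifLaw

lemma isProbabilityMeasure_unifLaw {u : ℝ} (hu : 0 < u) : IsProbabilityMeasure (unifLaw u) := by
  refine cond_isProbabilityMeasure_of_finite ?_ ?_ <;> simp [hu]

lemma ae_unifLaw_mem_Icc (u : ℝ) : ∀ᵐ z ∂(unifLaw u), z ∈ Set.Icc 0 u :=
  ae_cond_mem measurableSet_Icc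

lemma measure_noise_notMem {𝒳 : Type*} [MeasurableSpace 𝒳] {μ : Measure 𝒳} {u : ℝ} (hu : 0 < u) :
    ((μ.prod (unifLaw u)).prod (volume : Measure ℝ)) {q | q.1.2 ∉ Set.Icc 0 u} = 0 := by
  have := isProbabilityMeasure_unifLaw hu
  have h1 : (unifLaw u) {z | z ∉ Set.Icc 0 u} = 0 := ae_unifLaw_mem_Icc u
  exact (Measure.quasiMeasurePreserving_snd.comp
    (Measure.quasiMeasurePreserving_fst (μ := μ.prod (unifLaw u)) (ν := volume))).preimage_null h1

variable {𝒳 : Type*} [MeasurableSpace 𝒳] {μ : Measure 𝒳} [IsProbabilityMeasure μ] {u : ℝ}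

lemma measurePreserving_dropMiddle (hu : 0 < u) :
    MeasurePreserving (fun q : (𝒳 × ℝ) × ℝ => (q.1.1, q.2)) ((μ.prod (unifLaw u)).prod volume)
      (μ.prod volume) := by
  have := isProbabilityMeasure_unifLaw hu
  exact (measurePreserving_fst (μ := μ) (ν := unifLaw u)).prod (MeasurePreserving.id volume)

/-- Transfers inclusions valid for every noise value in [0, u] to measures on (x, y) alone; `S` need
not be measurable. -/
lemma measure_le_of_forall_noise (hu : 0 < u) {S : Set ((𝒳 × ℝ) × ℝ)} {T : Set (𝒳 × ℝ)}
    (hT : MeasurableSet T) (h : ∀ x z y, z ∈ Set.Icc 0 u → ((x, z), y) ∈ S → (x, y) ∈ T) :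
    ((μ.prod (unifLaw u)).prod volume) S ≤ (μ.prod volume) T := by
  rw [← (measurePreserving_dropMiddle (μ := μ) hu).measure_preimage hT.nullMeasurableSet]
  refine (measure_mono (t := (fun q => (q.1.1, q.2)) ⁻¹' T ∪ {q | q.1.2 ∉ Set.Icc 0 u}) fun q hq => ?_).trans
    ((measure_union_le _ _).trans_eq ?_)
  · by_cases hz : q.1.2 ∈ Set.Icc 0 u
    · exact Or.inl (h q.1.1 q.1.2 q.2 hz hq)
    · exact Or.inr hz
  · rw [measure_noise_notMem hu, add_zero]

lemma le_measure_of_forall_noise (hu : 0 < u) {S : Set ((𝒳 × ℝ) × ℝ)} {T : Set (𝒳 × ℝ)}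
    (hT : MeasurableSet T) (h : ∀ x z y, z ∈ Set.Icc 0 u → (x, y) ∈ T → ((x, z), y) ∈ S) :
    (μ.prod volume) T ≤ ((μ.prod (unifLaw u)).prod volume) S := by
  rw [← (measurePreserving_dropMiddle (μ := μ) hu).measure_preimage hT.nullMeasurableSet]
  refine (measure_mono (t := S ∪ {q | q.1.2 ∉ Set.Icc 0 u}) fun q hq => ?_).trans
    ((measure_union_le _ _).trans_eq ?_)
  · by_cases hz : q.1.2 ∈ Set.Icc 0 u
    · exact Or.inl (h q.1.1 q.1.2 q.2 hz hq)
    · exact Or.inr hz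
  · rw [measure_noise_notMem hu, add_zero]

end UnifLaw

/-! ### Population length of plug-in level sets -/

section PopulationLevel

/-- For fixed (x, z) the set of such y lies in a Gaussian level set, which has at most two points
because the thresholded variance is positive. -/
lemma measure_plugInDensity_eq {𝒳 : Type*} [MeasurableSpace 𝒳] {μ : Measure 𝒳} {u s : ℝ}
    {a b : 𝒳 → ℝ} (hs : 0 < s) (ha : Measurable a) (hb : Measurable b) (t : ℝ) :
    ((μ.prod (unifLaw u)).prod volume)
      {q : (𝒳 × ℝ) × ℝ | |q.2| ≤ s ∧ plugInDensity s a b q.1.1 q.1.2 q.2 = t} = 0 := by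
  have hm : MeasurableSet
      {q : (𝒳 × ℝ) × ℝ | |q.2| ≤ s ∧ plugInDensity s a b q.1.1 q.1.2 q.2 = t} :=
    (measurableSet_le measurable_snd.abs measurable_const).inter
      (measurable_plugInDensity ha hb (measurableSet_singleton t))
  rw [Measure.measure_prod_null hm]
  refine Eventually.of_forall fun w => ?_
  refine measure_mono_null (fun y hy => ?_) (volume_gaussianPDFReal_eq (a w.1) (t - w.2)
    (Real.toNNReal_pos.2 (threshold_pos hs (b w.1 ^ 2))).ne')
  have h2 : plugInDensity s a b w.1 w.2 y = t := hy.2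
  rw [plugInDensity_eq_of_le _ _ hy.1] at h2
  exact eq_sub_of_add_eq h2

variable {𝒳 : Type*} [MeasurableSpace 𝒳] {μ : Measure 𝒳} [IsProbabilityMeasure μ] {u s : ℝ}
  {a b : 𝒳 → ℝ}

/-- Expected length of `{y | p̂(y | X, ζ) > t}` for fixed estimators. -/
noncomputable def popG (μ : Measure 𝒳) (u s : ℝ) (a b : 𝒳 → ℝ) (t : ℝ) : ℝ≥0∞ :=
  ((μ.prod (unifLaw u)).prod volume)
    {q : (𝒳 × ℝ) × ℝ | t < plugInDensity s a b q.1.1 q.1.2 q.2}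

lemma measure_abs_le (hu : 0 < u) (s : ℝ) :
    ((μ.prod (unifLaw u)).prod volume) {q : (𝒳 × ℝ) × ℝ | |q.2| ≤ s} = ENNReal.ofReal (2 * s) := by
  have := isProbabilityMeasure_unifLaw hu
  have : {q : (𝒳 × ℝ) × ℝ | |q.2| ≤ s} = Set.univ ×ˢ Set.Icc (-s) s := by
    ext q
    simp [abs_le]
  rw [this, Measure.prod_prod]
  simp [two_mul]

lemma popG_le (hu : 0 < u) {t : ℝ} (ht : 0 ≤ t) : popG μ u s a b t ≤ ENNReal.ofReal (2 * s) := by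
  rw [← measure_abs_le (μ := μ) hu s]
  exact measure_mono fun q hq => abs_le_of_plugInDensity_pos (ht.trans_lt hq)

/-- The grid error is uniform over the fibres, so it survives averaging over (X, ζ). -/
lemma abs_integral_gridLength_sub_popG_le (hu : 0 < u) (hs : 0 ≤ s) (ha : Measurable a)
    (hb : Measurable b) {M : ℕ} (hM : 0 < M) {grid : Fin M → ℝ} (hg : IsGrid s grid) {t : ℝ}
    (ht : 0 ≤ t) :
    |∫ w, gridLength s grid a b t w ∂(μ.prod (unifLaw u)) - (popG μ u s a b t).toReal| ≤
      4 * s / M := by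
  have := isProbabilityMeasure_unifLaw hu
  have hms : MeasurableSet {q : (𝒳 × ℝ) × ℝ | t < plugInDensity s a b q.1.1 q.1.2 q.2} :=
    measurableSet_lt measurable_const (measurable_plugInDensity ha hb)
  have hfin : ∀ w : 𝒳 × ℝ, volume {y | t < plugInDensity s a b w.1 w.2 y} ≤
      ENNReal.ofReal (2 * s) := by
    intro w
    rw [superlevel_plugInDensity_eq ht]
    refine (measure_mono Set.inter_subset_right).trans ?_
    rw [Real.volume_Icc]
    exact ENNReal.ofReal_le_ofReal (by linarith)
  have hmeas : Measurable fun w : 𝒳 × ℝ => volume {y | t < plugInDensity s a b w.1 w.2 y} :=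
    measurable_measure_prodMk_left hms
  have hpop : (popG μ u s a b t).toReal =
      ∫ w : 𝒳 × ℝ, volume.real {y | t < plugInDensity s a b w.1 w.2 y} ∂(μ.prod (unifLaw u)) := by
    rw [popG, Measure.prod_apply hms]
    exact (integral_toReal hmeas.aemeasurable (Eventually.of_forall fun w =>
      (hfin w).trans_lt ENNReal.ofReal_lt_top)).symm
  have hi1 : Integrable (gridLength s grid a b t) (μ.prod (unifLaw u)) :=
    (memLp_of_bounded (Eventually.of_forall (gridLength_mem_Icc hs grid t))
      (measurable_gridLength ha hb grid t).aestronglyMeasurable 1).integrable le_rfl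
  have hi2 : Integrable (fun w : 𝒳 × ℝ => volume.real {y | t < plugInDensity s a b w.1 w.2 y})
      (μ.prod (unifLaw u)) := by
    refine (memLp_of_bounded (a := 0) (b := 2 * s) (Eventually.of_forall fun w => ⟨?_, ?_⟩)
      hmeas.ennreal_toReal.aestronglyMeasurable 1).integrable le_rfl
    · exact measureReal_nonneg
    · exact ENNReal.toReal_le_of_le_ofReal (by positivity) (hfin w)
  rw [hpop, ← integral_sub hi1 hi2, ← Real.norm_eq_abs]
  refine (norm_integral_le_of_norm_le_const (C := 4 * s / M) (Eventually.of_forall fun w => ?_)).trans ?_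
  · exact abs_gridLength_sub_volume_le hM hs hg ht w
  · simp

/-- The empirical length is close to the population length with high probability. -/
lemma measure_gridLength_deviation_le (hu : 0 < u) (hs : 0 ≤ s) (ha : Measurable a)
    (hb : Measurable b) {M N : ℕ} (hN : 0 < N) (grid : Fin M → ℝ) (t : ℝ) {κ : ℝ} (hκ : 0 < κ) :
    ((Measure.pi fun _ : Fin N => μ).prod (Measure.pi fun _ : Fin N => unifLaw u))
      {D | κ ≤ |empG s grid a b D.1 D.2 t - ∫ w, gridLength s grid a b t w ∂(μ.prod (unifLaw u))|} ≤
      ENNReal.ofReal ((2 * s) ^ 2 / (N * κ ^ 2)) := by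
  have := isProbabilityMeasure_unifLaw hu
  simp_rw [empG_eq_mean]
  exact measure_mean_deviation_prod_le μ (unifLaw u) (measurable_gridLength ha hb grid t)
    (gridLength_mem_Icc hs grid t) hN hκ

lemma measurable_empG (ha : Measurable a) (hb : Measurable b) {M N : ℕ} (grid : Fin M → ℝ)
    (t : ℝ) :
    Measurable fun D : (Fin N → 𝒳) × (Fin N → ℝ) => empG s grid a b D.1 D.2 t := by
  simp_rw [empG_eq_mean]
  refine Measurable.const_mul (Finset.measurable_sum _ fun i _ => ?_) _
  exact (measurable_gridLength ha hb grid t).comp (by fun_prop)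

/-- Every length in `(0, 2 s)` is attained by a superlevel set of the plug-in density. -/
lemma exists_popG_eq (hu : 0 < u) (hs : 0 < s) (ha : Measurable a) (hb : Measurable b) {c : ℝ}
    (hc1 : 1 ≤ c) (hc2 : c < 2 * s) :
    ∃ t, 0 < t ∧ popG μ u s a b t = ENNReal.ofReal c ∧
      ((μ.prod (unifLaw u)).prod volume)
        {q : (𝒳 × ℝ) × ℝ | t ≤ plugInDensity s a b q.1.1 q.1.2 q.2} = ENNReal.ofReal c := by
  have := isProbabilityMeasure_unifLaw hu
  set W' := (μ.prod (unifLaw u)).prod (volume : Measure ℝ) with hW'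
  set A : Set ((𝒳 × ℝ) × ℝ) := {q | |q.2| ≤ s} with hA
  set pl : (𝒳 × ℝ) × ℝ → ℝ := fun q => plugInDensity s a b q.1.1 q.1.2 q.2 with hpl
  have hplm : Measurable pl := measurable_plugInDensity ha hb
  have hAm : MeasurableSet A := measurableSet_le measurable_snd.abs measurable_const
  have hWA : W' A = ENNReal.ofReal (2 * s) := measure_abs_le hu s
  have hfin : IsFiniteMeasure (W'.restrict A) := 
    ⟨by rw [Measure.restrict_apply_univ, hWA]; exact ENNReal.ofReal_lt_top⟩
  have hlev : ∀ t, MeasurableSet {q | t ≤ pl q} := fun t => measurableSet_le measurable_const hplm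
  set F : ℝ → ℝ := fun t => ∫ q, {q | t ≤ pl q}.indicator 1 q ∂(W'.restrict A) with hF
  have hFeq : ∀ t, F t = (W'.restrict A).real {q | t ≤ pl q} := fun t => integral_indicator_one (hlev t)
  -- Dominated convergence: off the null level set at t₀ the indicator is locally constant in t.
  -- Restricting to |y| ≤ s gives finite measure and removes the atom at level 0.
  have hcont : Continuous F := by
    rw [continuous_iff_continuousAt]
    intro t₀
    refine continuousAt_of_dominated (bound := fun _ => 1) (Eventually.of_forall fun t =>
      (measurable_one.indicator (hlev t)).aestronglyMeasurable) (Eventually.of_forall fun t =>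
      Eventually.of_forall fun q => ?_) (integrable_const _) ?_
    · by_cases h : q ∈ {q | t ≤ pl q} <;> simp [h]
    · rw [ae_restrict_iff' hAm]
      have h0 : ∀ᵐ q ∂W', ¬ (|q.2| ≤ s ∧ pl q = t₀) := by
        rw [ae_iff]
        simpa using measure_plugInDensity_eq (μ := μ) (u := u) hs ha hb t₀
      filter_upwards [h0] with q hq hqA
      have hne : pl q ≠ t₀ := fun h => hq ⟨hqA, h⟩
      rcases lt_or_gt_of_ne hne with h | h
      · refine (continuousAt_const (y := (0 : ℝ))).congr ?_
        filter_upwards [eventually_gt_nhds h] with t ht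
        rw [Set.indicator_of_notMem]
        exact not_le.2 ht
      · refine (continuousAt_const (y := (1 : ℝ))).congr ?_
        filter_upwards [eventually_lt_nhds h] with t ht
        rw [Set.indicator_of_mem (show q ∈ {q | t ≤ pl q} from ht.le)]
        rfl
  have hF0 : 2 * s ≤ F 0 := by
    rw [hFeq, measureReal_restrict_apply (hlev 0)]
    have : ENNReal.ofReal (2 * s) ≤ W' ({q | 0 ≤ pl q} ∩ A) := by
      rw [← hWA]
      refine (measure_mono (t := ({q | 0 ≤ pl q} ∩ A) ∪ {q | q.1.2 ∉ Set.Icc 0 u})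
        fun q hq => ?_).trans ((measure_union_le _ _).trans_eq ?_)
      · by_cases hz : q.1.2 ∈ Set.Icc 0 u
        · refine Or.inl ⟨?_, hq⟩
          have := gaussianPDFReal_nonneg (a q.1.1) (threshold s (b q.1.1 ^ 2)).toNNReal q.2
          simp only [hpl, Set.mem_ofPred_eq, plugInDensity_eq_of_le _ _ (show |q.2| ≤ s from hq)]
          linarith [hz.1]
        · exact Or.inr hz
      · rw [measure_noise_notMem hu, add_zero]
    refine (ENNReal.ofReal_le_iff_le_toReal ?_).1 this
    exact ne_top_of_le_ne_top (hWA ▸ ENNReal.ofReal_ne_top) (measure_mono Set.inter_subset_right)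
  -- The noise is at most u, so the Gaussian part must be at least 1, on a fibre of length at most 1
  -- by Markov.
  have hF1 : F (u + 1) ≤ c := by
    rw [hFeq, measureReal_restrict_apply (hlev _)]
    refine ENNReal.toReal_le_of_le_ofReal (by linarith) ?_
    have hgm : Measurable fun q : 𝒳 × ℝ =>
        gaussianPDFReal (a q.1) (threshold s (b q.1 ^ 2)).toNNReal q.2 :=
      measurable_gaussianPDFReal_comp (ha.comp measurable_fst)
        ((measurable_threshold s).comp ((hb.comp measurable_fst).pow_const 2)) measurable_snd
    have hTm : MeasurableSet {q : 𝒳 × ℝ |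
        1 ≤ gaussianPDFReal (a q.1) (threshold s (b q.1 ^ 2)).toNNReal q.2} :=
      measurableSet_le measurable_const hgm
    refine (measure_le_of_forall_noise (μ := μ) hu hTm ?_).trans ?_
    · rintro x z y hz ⟨h1, h2⟩
      simp only [hpl, Set.mem_ofPred_eq, plugInDensity_eq_of_le _ _ (show |y| ≤ s from h2)] at h1 ⊢
      linarith [hz.2]
    · rw [Measure.prod_apply hTm]
      refine (lintegral_mono fun x => volume_le_gaussianPDFReal_le (a x)
        (threshold s (b x ^ 2)).toNNReal one_pos).trans ?_
      simpa using hc1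
  obtain ⟨t, ht, hFt⟩ := intermediate_value_Icc' (by linarith : (0 : ℝ) ≤ u + 1) hcont.continuousOn
    ⟨hF1, hc2.le.trans hF0⟩
  have ht0 : 0 < t := by
    refine lt_of_le_of_ne ht.1 fun h => ?_
    rw [h, hFt] at hF0
    linarith
  have hsub : {q | t ≤ pl q} ∩ A = {q | t ≤ pl q} :=
    Set.inter_eq_left.2 fun q hq => abs_le_of_plugInDensity_pos (ht0.trans_le hq)
  have hle : W' {q | t ≤ pl q} = ENNReal.ofReal c := by
    rw [← hFt, hFeq, measureReal_restrict_apply (hlev t), hsub, measureReal_def, ENNReal.ofReal_toReal]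
    exact ne_top_of_le_ne_top (hWA ▸ ENNReal.ofReal_ne_top)
      (measure_mono fun q hq => abs_le_of_plugInDensity_pos (ht0.trans_le hq))
  refine ⟨t, ht0, ?_, hle⟩
  rw [← hle]
  refine le_antisymm (measure_mono fun q hq => LT.lt.le (a := t) hq) ?_
  refine (measure_mono (t := {q | t < pl q} ∪ {q | |q.2| ≤ s ∧ pl q = t}) fun q hq => ?_).trans
    ((measure_union_le _ _).trans_eq ?_)
  · rcases lt_or_eq_of_le (show t ≤ pl q from hq) with h | h
    · exact Or.inl h
    · exact Or.inr ⟨abs_le_of_plugInDensity_pos (ht0.trans_le hq), h.symm⟩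
  · rw [measure_plugInDensity_eq hs ha hb, add_zero]
    rfl

end PopulationLevel

/-! ### Comparing plug-in and true level sets -/

section FixedEstimators

variable {𝒳 : Type*} [MeasurableSpace 𝒳] {μ : Measure 𝒳} [IsProbabilityMeasure μ] {u s : ℝ}
  {f σ a b : 𝒳 → ℝ}

/-- Pairs `(x, y)` with `|y| ≤ s` at which the plug-in density and the true one differ by more than
`δ`. -/
def discrepancySet (f σ a b : 𝒳 → ℝ) (s δ : ℝ) : Set (𝒳 × ℝ) :=
  {q | |q.2| ≤ s ∧ δ < |gaussianPDFReal (a q.1) (threshold s (b q.1 ^ 2)).toNNReal q.2 -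
    condDensity f σ q.1 q.2|}

lemma measurableSet_discrepancySet (hf : Measurable f) (hσ : Measurable σ) (ha : Measurable a)
    (hb : Measurable b) (s δ : ℝ) : MeasurableSet (discrepancySet f σ a b s δ) := by
  have hg : Measurable fun q : 𝒳 × ℝ =>
      gaussianPDFReal (a q.1) (threshold s (b q.1 ^ 2)).toNNReal q.2 :=
    measurable_gaussianPDFReal_comp (ha.comp measurable_fst)
      ((measurable_threshold s).comp ((hb.comp measurable_fst).pow_const 2)) measurable_snd
  exact (measurableSet_le measurable_snd.abs measurable_const).inter
    (measurableSet_lt measurable_const (hg.sub (measurable_condDensity hf hσ)).abs)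

lemma measurableSet_tail (hf : Measurable f) (hσ : Measurable σ) (s t : ℝ) :
    MeasurableSet {q : 𝒳 × ℝ | s < |q.2| ∧ t ≤ condDensity f σ q.1 q.2} :=
  (measurableSet_lt measurable_const measurable_snd.abs).inter
    (measurableSet_le measurable_const (measurable_condDensity hf hσ))

/-- Off the discrepancy set, passing from the plug-in density to p loses at most δ for the estimate
and u ≤ δ for the noise. -/
lemma popG_le_bigG_add (hf : Measurable f) (hσ : Measurable σ) (ha : Measurable a)
    (hb : Measurable b) (hu : 0 < u) {δ t : ℝ} (hδ : 0 < δ) (huδ : u ≤ δ) (ht : 0 ≤ t) :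
    popG μ u s a b (t + 3 * δ) ≤
      bigG μ f σ (t + δ) + (μ.prod volume) (discrepancySet f σ a b s δ) := by
  have hm := measurable_condDensity hf hσ
  have hd := measurableSet_discrepancySet hf hσ ha hb s δ
  have hl : MeasurableSet {q : 𝒳 × ℝ | t + δ ≤ condDensity f σ q.1 q.2} :=
    measurableSet_le measurable_const hm
  rw [bigG_eq hf hσ]
  refine le_trans ?_ (measure_union_le _ _)
  refine measure_le_of_forall_noise hu (hl.union hd) fun x z y hz hq => ?_
  have hq' : t + 3 * δ < plugInDensity s a b x z y := hq
  have hy : |y| ≤ s := abs_le_of_plugInDensity_pos (lt_of_le_of_lt (by positivity) hq')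
  rw [plugInDensity_eq_of_le _ _ hy] at hq'
  by_cases h : δ < |gaussianPDFReal (a x) (threshold s (b x ^ 2)).toNNReal y - condDensity f σ x y|
  · exact Or.inr ⟨hy, h⟩
  · left
    have h1 := (abs_le.1 (not_lt.1 h)).2
    simp only [Set.mem_ofPred_eq]
    linarith [hz.2]

/-- The noise is nonnegative and helps here, so only δ is lost; lowering the level by 2δ yields the
strict inequality in `popG`. Truncation adds the tail term. -/
lemma bigG_le_popG_add (hf : Measurable f) (hσ : Measurable σ) (ha : Measurable a)
    (hb : Measurable b) (hu : 0 < u) {δ t : ℝ} (hδ : 0 < δ) :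
    bigG μ f σ (t - δ) ≤ popG μ u s a b (t - 3 * δ) +
      ((μ.prod volume) {q | s < |q.2| ∧ t - δ ≤ condDensity f σ q.1 q.2} +
        (μ.prod volume) (discrepancySet f σ a b s δ)) := by
  have hm := measurable_condDensity hf hσ
  have hd := measurableSet_discrepancySet hf hσ ha hb s δ
  have hl : MeasurableSet {q : 𝒳 × ℝ | t - δ ≤ condDensity f σ q.1 q.2} :=
    measurableSet_le measurable_const hm
  have ht := measurableSet_tail hf hσ s (t - δ)
  rw [bigG_eq hf hσ]
  set E := {q : 𝒳 × ℝ | s < |q.2| ∧ t - δ ≤ condDensity f σ q.1 q.2} ∪ discrepancySet f σ a b s δ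
    with hE
  have hEm : MeasurableSet E := ht.union hd
  have h1 : (μ.prod volume) ({q : 𝒳 × ℝ | t - δ ≤ condDensity f σ q.1 q.2} \ E) ≤
      popG μ u s a b (t - 3 * δ) := by
    refine le_measure_of_forall_noise hu (hl.diff hEm) fun x z y hz hq => ?_
    obtain ⟨hq1, hq2⟩ := hq
    simp only [hE, Set.mem_union, not_or] at hq2
    have hq1' : t - δ ≤ condDensity f σ x y := hq1
    have hy : |y| ≤ s := by
      by_contra h
      exact hq2.1 ⟨not_le.1 h, hq1⟩
    have h2 : |gaussianPDFReal (a x) (threshold s (b x ^ 2)).toNNReal y - condDensity f σ x y| ≤ δ := by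
      by_contra h
      exact hq2.2 ⟨hy, not_le.1 h⟩
    have h3 := (abs_le.1 h2).1
    simp only [Set.mem_ofPred_eq, plugInDensity_eq_of_le _ _ hy]
    linarith [hz.1]
  calc _ ≤ (μ.prod volume) ({q : 𝒳 × ℝ | t - δ ≤ condDensity f σ q.1 q.2} \ E) +
        (μ.prod volume) E := by
        refine (measure_mono fun q hq => ?_).trans (measure_union_le _ _)
        by_cases h : q ∈ E
        · exact Or.inr h
        · exact Or.inl ⟨hq, h⟩
    _ ≤ _ := add_le_add h1 (measure_union_le _ _)

/-- Symmetric difference between the level set of `p` at `lam` and that of `p̂` at `r`. -/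
def levelDiff (f σ a b : 𝒳 → ℝ) (s lam r : ℝ) : Set ((𝒳 × ℝ) × ℝ) :=
  {q | r ≤ plugInDensity s a b q.1.1 q.1.2 q.2} ∆ {q | lam ≤ condDensity f σ q.1.1 q.2}

lemma levelDiff_subset_union {𝒳 : Type*} (f σ a b : 𝒳 → ℝ) (s lam r : ℝ) :
    levelDiff f σ a b s lam r ⊆ {q | r ≤ plugInDensity s a b q.1.1 q.1.2 q.2} ∪
      {q | lam ≤ condDensity f σ q.1.1 q.2} :=
  Set.symmDiff_subset_union

lemma measure_trueLevel (hf : Measurable f) (hσ : Measurable σ) (hu : 0 < u) (lam : ℝ) :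
    ((μ.prod (unifLaw u)).prod volume)
      {q : (𝒳 × ℝ) × ℝ | lam ≤ condDensity f σ q.1.1 q.2} ≤ bigG μ f σ lam := by
  rw [bigG_eq hf hσ]
  exact measure_le_of_forall_noise hu
    (measurableSet_le measurable_const (measurable_condDensity hf hσ)) fun x z y _ h => h

/-- Fallback when Ĝ is inaccurate: a positive threshold confines the predictor to [-s, s]. -/
lemma measure_levelDiff_le_of_pos (hf : Measurable f) (hσ : Measurable σ) (hu : 0 < u)
    {lam r : ℝ} (hr : 0 < r) :
    ((μ.prod (unifLaw u)).prod volume) (levelDiff f σ a b s lam r) ≤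
      ENNReal.ofReal (2 * s) + bigG μ f σ lam := by
  refine (measure_mono (levelDiff_subset_union f σ a b s lam r)).trans
    ((measure_union_le _ _).trans (add_le_add ?_ (measure_trueLevel hf hσ hu lam)))
  rw [← measure_abs_le (μ := μ) hu s]
  exact measure_mono fun q hq => abs_le_of_plugInDensity_pos (hr.trans_le hq)

lemma measure_levelDiff_le_of_le (hf : Measurable f) (hσ : Measurable σ) (hu : 0 < u)
    {lam r t : ℝ} (hr : t ≤ r) :
    ((μ.prod (unifLaw u)).prod volume) (levelDiff f σ a b s lam r) ≤
      ((μ.prod (unifLaw u)).prod volume)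
        {q : (𝒳 × ℝ) × ℝ | t ≤ plugInDensity s a b q.1.1 q.1.2 q.2} + bigG μ f σ lam := by
  refine (measure_mono (levelDiff_subset_union f σ a b s lam r)).trans
    ((measure_union_le _ _).trans (add_le_add ?_ (measure_trueLevel hf hσ hu lam)))
  exact measure_mono fun q hq => hr.trans hq

lemma measure_levelDiff_le_of_near (hf : Measurable f) (hσ : Measurable σ) (ha : Measurable a)
    (hb : Measurable b) (hu : 0 < u) {δ lam r : ℝ} (hδ : 0 < δ) (huδ : u ≤ δ) (hlam : 5 * δ < lam)
    (h1 : lam - 3 * δ ≤ r) (h2 : r ≤ lam + 3 * δ) :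
    ((μ.prod (unifLaw u)).prod volume) (levelDiff f σ a b s lam r) ≤
      (μ.prod volume) {q | |condDensity f σ q.1 q.2 - lam| ≤ 5 * δ} +
      ((μ.prod volume) {q | s < |q.2| ∧ lam - δ ≤ condDensity f σ q.1 q.2} +
        (μ.prod volume) (discrepancySet f σ a b s δ)) := by
  have hd := measurableSet_discrepancySet hf hσ ha hb s δ
  have ht := measurableSet_tail hf hσ s (lam - δ)
  have hn : MeasurableSet {q : 𝒳 × ℝ | |condDensity f σ q.1 q.2 - lam| ≤ 5 * δ} :=
    measurableSet_le ((measurable_condDensity hf hσ).sub_const lam).abs measurable_const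
  refine (measure_le_of_forall_noise hu (hn.union (ht.union hd)) fun x z y hz hq => ?_).trans
    ((measure_union_le _ _).trans (add_le_add le_rfl (measure_union_le _ _)))
  by_cases hdis : (x, y) ∈ discrepancySet f σ a b s δ
  · exact Or.inr (Or.inr hdis)
  have habs : |y| ≤ s →
      |gaussianPDFReal (a x) (threshold s (b x ^ 2)).toNNReal y - condDensity f σ x y| ≤ δ := by
    intro hy
    by_contra h
    exact hdis ⟨hy, not_le.1 h⟩
  rcases hq with ⟨hq1, hq2⟩ | ⟨hq1, hq2⟩
  · left
    have hq1' : r ≤ plugInDensity s a b x z y := hq1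
    have hy : |y| ≤ s := abs_le_of_plugInDensity_pos (lt_of_lt_of_le (by linarith) hq1')
    rw [plugInDensity_eq_of_le _ _ hy] at hq1'
    have hq2' : condDensity f σ x y < lam := not_le.1 hq2
    have h3 := abs_le.1 (habs hy)
    simp only [Set.mem_ofPred_eq, abs_le]
    constructor <;> linarith [hz.1, hz.2, h3.1, h3.2]
  · have hq1' : lam ≤ condDensity f σ x y := hq1
    by_cases hy : |y| ≤ s
    · left
      have hq2' : plugInDensity s a b x z y < r := not_le.1 hq2
      rw [plugInDensity_eq_of_le _ _ hy] at hq2'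
      have h3 := abs_le.1 (habs hy)
      simp only [Set.mem_ofPred_eq, abs_le]
      constructor <;> linarith [hz.1, hz.2, h3.1, h3.2]
    · refine Or.inr (Or.inl ⟨not_le.1 hy, ?_⟩)
      show lam - δ ≤ condDensity f σ x y
      linarith

/-- Almost every section of an optimal predictor agrees with the level set up to a null set, so the
triangle inequality for symmetric differences costs nothing. -/
lemma symmDiffLength_le_measure_levelDiff (hf : Measurable f) (hσ : Measurable σ)
    (hpos : ∀ x, 0 < σ x)
    (hc : ∀ y : ℝ, ContinuousOn (fun t : ℝ => μ {x | t ≤ condDensity f σ x y}) (Set.Ioi 0))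
    {ℓ : ℝ} (hℓ : 0 < ℓ) {Γs : 𝒳 → Set ℝ} (hΓs : IsOptimalPredictor μ f σ ℓ Γs)
    (ha : Measurable a) (hb : Measurable b) (hu : 0 < u) (r : ℝ) :
    symmDiffLength μ (unifLaw u) Γs (fun w => {y | r ≤ plugInDensity s a b w.1 w.2 y}) ≤
      ((μ.prod (unifLaw u)).prod volume) (levelDiff f σ a b s (lamStar μ f σ ℓ) r) := by
  have := isProbabilityMeasure_unifLaw hu
  have hm : MeasurableSet (levelDiff f σ a b s (lamStar μ f σ ℓ) r) := by
    refine (measurableSet_le measurable_const (measurable_plugInDensity ha hb)).symmDiff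
      (measurableSet_le measurable_const ?_)
    exact (measurable_condDensity hf hσ).comp
      (by fun_prop : Measurable fun q : (𝒳 × ℝ) × ℝ => (q.1.1, q.2))
  rw [Measure.prod_apply hm, symmDiffLength]
  refine lintegral_mono_ae ?_
  have h0 := measure_symmDiff_levelPredictor_eq_zero hf hσ hpos hc hℓ hΓs
  have h1 : ∀ᵐ w ∂(μ.prod (unifLaw u)), volume (Γs w.1 ∆ levelPredictor μ f σ ℓ w.1) = 0 :=
    Measure.quasiMeasurePreserving_fst.ae h0
  filter_upwards [h1] with w hw
  refine (measure_mono (symmDiff_triangle _ (levelPredictor μ f σ ℓ w.1) _)).trans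
    ((measure_union_le _ _).trans ?_)
  rw [symmDiff_comm (levelPredictor μ f σ ℓ w.1), hw, add_zero]
  rfl

end FixedEstimators

/-! ### Error bound conditional on the labelled sample -/

section FixedLabelledSample

variable {𝒳 : Type*} [MeasurableSpace 𝒳] {μ : Measure 𝒳} [IsProbabilityMeasure μ] {u s : ℝ}
  {f σ a b : 𝒳 → ℝ}

/-- When the empirical lengths at three well-chosen thresholds are accurate, the predictor is close
to the optimal one. -/
lemma symmDiffLength_empPredictor_le (hf : Measurable f) (hσ : Measurable σ)
    (hpos : ∀ x, 0 < σ x)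
    (hc : ∀ y : ℝ, ContinuousOn (fun t : ℝ => μ {x | t ≤ condDensity f σ x y}) (Set.Ioi 0))
    {ℓ : ℝ} (hℓ : 0 < ℓ) {Γs : 𝒳 → Set ℝ} (hΓs : IsOptimalPredictor μ f σ ℓ Γs)
    (ha : Measurable a) (hb : Measurable b) (hu : 0 < u) (hs : 0 < s)
    {M N : ℕ} {grid : Fin M → ℝ} {δ κ : ℝ} (hδ : 0 < δ) (huδ : u ≤ δ)
    (hlam : 5 * δ < lamStar μ f σ ℓ) (hκ : 0 < κ) (hκ1 : 2 * κ ≤ 1)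
    (hup : (bigG μ f σ (lamStar μ f σ ℓ + δ)).toReal + 3 * κ ≤ ℓ)
    (hlo : ℓ + 4 * κ ≤ (bigG μ f σ (lamStar μ f σ ℓ - δ)).toReal)
    (htail : (μ.prod volume)
      {q | s < |q.2| ∧ lamStar μ f σ ℓ - δ ≤ condDensity f σ q.1 q.2} ≤ ENNReal.ofReal κ)
    {t₀ : ℝ} (ht₀ : popG μ u s a b t₀ = ENNReal.ofReal (ℓ + 1))
    (ht₀' : ((μ.prod (unifLaw u)).prod volume)
        {q : (𝒳 × ℝ) × ℝ | t₀ ≤ plugInDensity s a b q.1.1 q.1.2 q.2} = ENNReal.ofReal (ℓ + 1))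
    {xs : Fin N → 𝒳} {zs : Fin N → ℝ}
    (hdev : ∀ t ∈ ({t₀, lamStar μ f σ ℓ + 3 * δ, lamStar μ f σ ℓ - 3 * δ} : Set ℝ),
      |empG s grid a b xs zs t - (popG μ u s a b t).toReal| < 2 * κ) :
    symmDiffLength μ (unifLaw u) Γs (empPredictor s grid a b xs zs ℓ) ≤
      (μ.prod volume) {q | |condDensity f σ q.1 q.2 - lamStar μ f σ ℓ| ≤ 5 * δ} +
      ((μ.prod volume) {q | s < |q.2| ∧ lamStar μ f σ ℓ - δ ≤ condDensity f σ q.1 q.2} +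
        ENNReal.ofReal (1 + (2 * ℓ + 1) / κ) * (μ.prod volume) (discrepancySet f σ a b s δ)) := by
  set lam := lamStar μ f σ ℓ with hlamdef
  set r := genInv (empG s grid a b xs zs) ℓ with hr
  set Δ := (μ.prod volume) (discrepancySet f σ a b s δ) with hΔ
  have hG := bigG_lamStar hf hσ hpos hc hℓ
  have hd0 := hdev t₀ (by simp)
  have hd1 := hdev (lam + 3 * δ) (by simp)
  have hd2 := hdev (lam - 3 * δ) (by simp)
  refine (symmDiffLength_le_measure_levelDiff hf hσ hpos hc hℓ hΓs ha hb hu r).trans ?_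
  rw [ENNReal.ofReal_add zero_le_one (by positivity), add_mul, ENNReal.ofReal_one, one_mul]
  -- Good estimates localize the threshold; bad ones are charged to Δ itself.
  by_cases hΔκ : Δ ≤ ENNReal.ofReal κ
  · have hb1 : bigG μ f σ (lam + δ) ≠ ∞ := bigG_ne_top hf hσ (by linarith)
    have hb2 : bigG μ f σ (lam - δ) ≠ ∞ := bigG_ne_top hf hσ (by linarith)
    have hp2 : popG μ u s a b (lam - 3 * δ) ≠ ∞ :=
      ne_top_of_le_ne_top ENNReal.ofReal_ne_top (popG_le hu (by linarith))
    -- Otherwise ℓ < Ĝ(λ* + 3δ) < G(λ* + δ) + κ + 2κ, against `hup`: one κ for Δ, two for the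
    -- deviation.
    have h1 : r ≤ lam + 3 * δ := by
      by_contra h
      have he := lt_empG_of_lt_genInv (by linarith) (not_le.1 h)
      have hP : popG μ u s a b (lam + 3 * δ) ≤ bigG μ f σ (lam + δ) + ENNReal.ofReal κ :=
        (popG_le_bigG_add hf hσ ha hb hu hδ huδ (by linarith)).trans (add_le_add le_rfl hΔκ)
      have hP' := ENNReal.toReal_mono (by simp [hb1]) hP
      rw [ENNReal.toReal_add hb1 ENNReal.ofReal_ne_top, ENNReal.toReal_ofReal hκ.le] at hP'
      linarith [(abs_lt.1 hd1).2]
    -- Otherwise G(λ* - δ) < Ĝ(λ* - 3δ) + 4κ ≤ ℓ + 4κ, against `hlo`: the tail, Δ and the deviation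
    -- cost κ, κ and 2κ.
    have h2 : lam - 3 * δ ≤ r := by
      by_contra h
      have he := empG_le_of_genInv_lt hs.le hℓ (not_le.1 h)
      have hP : bigG μ f σ (lam - δ) ≤ popG μ u s a b (lam - 3 * δ) +
          (ENNReal.ofReal κ + ENNReal.ofReal κ) :=
        (bigG_le_popG_add hf hσ ha hb hu hδ).trans (add_le_add le_rfl (add_le_add htail hΔκ))
      have hP' := ENNReal.toReal_mono (by simp [hp2]) hP
      rw [ENNReal.toReal_add hp2 (by simp), ENNReal.toReal_add (by simp) (by simp),
        ENNReal.toReal_ofReal hκ.le] at hP'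
      linarith [(abs_lt.1 hd2).1]
    refine (measure_levelDiff_le_of_near hf hσ ha hb hu hδ huδ hlam h2 h1).trans ?_
    gcongr
    exact le_self_add
  -- At t₀ the population length is ℓ + 1 and the deviation is below 2κ ≤ 1, so Ĝ(t₀) > ℓ.
  · have h0 : t₀ ≤ r := by
      by_contra h
      have he := empG_le_of_genInv_lt hs.le hℓ (not_le.1 h)
      rw [ht₀, ENNReal.toReal_ofReal (by linarith)] at hd0
      linarith [(abs_lt.1 hd0).1]
    refine (measure_levelDiff_le_of_le hf hσ hu h0).trans ?_
    rw [ht₀', hG, ← ENNReal.ofReal_add (by linarith) hℓ.le]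
    calc ENNReal.ofReal (ℓ + 1 + ℓ) = ENNReal.ofReal ((2 * ℓ + 1) / κ) * ENNReal.ofReal κ := by
          rw [← ENNReal.ofReal_mul (by positivity)]
          congr 1
          field_simp
          ring
      _ ≤ ENNReal.ofReal ((2 * ℓ + 1) / κ) * Δ := by
          gcongr
          exact (not_le.1 hΔκ).le
      _ ≤ _ := le_add_self.trans (le_add_self.trans le_add_self)

lemma lintegral_symmDiffLength_empPredictor_le (hf : Measurable f) (hσ : Measurable σ)
    (hpos : ∀ x, 0 < σ x)
    (hc : ∀ y : ℝ, ContinuousOn (fun t : ℝ => μ {x | t ≤ condDensity f σ x y}) (Set.Ioi 0))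
    {ℓ : ℝ} (hℓ : 0 < ℓ) {Γs : 𝒳 → Set ℝ} (hΓs : IsOptimalPredictor μ f σ ℓ Γs)
    (ha : Measurable a) (hb : Measurable b) (hu : 0 < u) (hs : ℓ + 1 < 2 * s)
    {M N : ℕ} (hM : 0 < M) (hN : 0 < N) {grid : Fin M → ℝ} (hg : IsGrid s grid)
    {δ κ : ℝ} (hδ : 0 < δ) (huδ : u ≤ δ)
    (hlam : 5 * δ < lamStar μ f σ ℓ) (hκ : 0 < κ) (hκ1 : 2 * κ ≤ 1)
    (hup : (bigG μ f σ (lamStar μ f σ ℓ + δ)).toReal + 3 * κ ≤ ℓ)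
    (hlo : ℓ + 4 * κ ≤ (bigG μ f σ (lamStar μ f σ ℓ - δ)).toReal)
    (htail : (μ.prod volume)
      {q | s < |q.2| ∧ lamStar μ f σ ℓ - δ ≤ condDensity f σ q.1 q.2} ≤ ENNReal.ofReal κ)
    (hMκ : 4 * s / M ≤ κ) :
    ∫⁻ D, symmDiffLength μ (unifLaw u) Γs (empPredictor s grid a b D.1 D.2 ℓ)
        ∂((Measure.pi fun _ : Fin N => μ).prod (Measure.pi fun _ : Fin N => unifLaw u)) ≤
      (μ.prod volume) {q | |condDensity f σ q.1 q.2 - lamStar μ f σ ℓ| ≤ 5 * δ} +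
      ((μ.prod volume) {q | s < |q.2| ∧ lamStar μ f σ ℓ - δ ≤ condDensity f σ q.1 q.2} +
        ENNReal.ofReal (1 + (2 * ℓ + 1) / κ) * (μ.prod volume) (discrepancySet f σ a b s δ)) +
      ENNReal.ofReal ((2 * s + ℓ) * (3 * ((2 * s) ^ 2 / (N * κ ^ 2)))) := by
  have hν := isProbabilityMeasure_unifLaw hu
  have hs0 : 0 < s := by linarith
  set lam := lamStar μ f σ ℓ with hlamdef
  set Pr := (Measure.pi fun _ : Fin N => μ).prod (Measure.pi fun _ : Fin N => unifLaw u) with hPr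
  set H₀ := (μ.prod volume) {q | |condDensity f σ q.1 q.2 - lam| ≤ 5 * δ} +
      ((μ.prod volume) {q | s < |q.2| ∧ lam - δ ≤ condDensity f σ q.1 q.2} +
        ENNReal.ofReal (1 + (2 * ℓ + 1) / κ) * (μ.prod volume) (discrepancySet f σ a b s δ)) with hH₀
  -- t₀ depends on the labelled sample only, so Chebyshev applies at it as at a deterministic
  -- threshold.
  obtain ⟨t₀, ht₀pos, ht₀, ht₀'⟩ := exists_popG_eq (μ := μ) hu hs0 ha hb (by linarith : 1 ≤ ℓ + 1) hs
  set bad : ℝ → Set ((Fin N → 𝒳) × (Fin N → ℝ)) := fun t =>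
    {D | κ ≤ |empG s grid a b D.1 D.2 t - ∫ w, gridLength s grid a b t w ∂(μ.prod (unifLaw u))|}
    with hbad
  have hbadm : ∀ t, MeasurableSet (bad t) := fun t =>
    measurableSet_le measurable_const ((measurable_empG ha hb grid t).sub_const _).abs
  have hbadP : ∀ t, Pr (bad t) ≤ ENNReal.ofReal ((2 * s) ^ 2 / (N * κ ^ 2)) := fun t =>
    measure_gridLength_deviation_le hu hs0.le ha hb hN grid t hκ
  set B := bad t₀ ∪ (bad (lam + 3 * δ) ∪ bad (lam - 3 * δ)) with hB
  have hBm : MeasurableSet B := (hbadm _).union ((hbadm _).union (hbadm _))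
  have hBP : Pr B ≤ ENNReal.ofReal (3 * ((2 * s) ^ 2 / (N * κ ^ 2))) := by
    refine (measure_union_le _ _).trans ((add_le_add (hbadP _) ((measure_union_le _ _).trans
      (add_le_add (hbadP _) (hbadP _)))).trans_eq ?_)
    rw [← ENNReal.ofReal_add (by positivity) (by positivity),
      ← ENNReal.ofReal_add (by positivity) (by positivity)]
    congr 1
    ring
  have hz : ∀ᵐ D ∂Pr, ∀ i, 0 ≤ D.2 i := by
    rw [ae_all_iff]
    intro i
    have h1 : ∀ᵐ z ∂(unifLaw u), 0 ≤ z := (ae_unifLaw_mem_Icc u).mono fun z hz => hz.1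
    exact ((measurePreserving_eval (fun _ : Fin N => unifLaw u) i).quasiMeasurePreserving.comp
      Measure.quasiMeasurePreserving_snd).ae h1
  have hpt : ∀ᵐ D ∂Pr, symmDiffLength μ (unifLaw u) Γs (empPredictor s grid a b D.1 D.2 ℓ) ≤
      H₀ + B.indicator (fun _ => ENNReal.ofReal (2 * s + ℓ)) D := by
    filter_upwards [hz] with D hD
    by_cases hDB : D ∈ B
    · rw [Set.indicator_of_mem hDB]
      refine le_trans ?_ le_add_self
      refine (symmDiffLength_le_measure_levelDiff hf hσ hpos hc hℓ hΓs ha hb hu _).trans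
        ((measure_levelDiff_le_of_pos hf hσ hu
          (genInv_empG_pos hM hN hs0 hg D.1 hD hℓ (by linarith))).trans_eq ?_)
      rw [bigG_lamStar hf hσ hpos hc hℓ, ← ENNReal.ofReal_add (by positivity) hℓ.le]
    · refine le_trans ?_ le_self_add
      refine symmDiffLength_empPredictor_le hf hσ hpos hc hℓ hΓs ha hb hu hs0 hδ huδ hlam hκ hκ1 hup
        hlo htail ht₀ ht₀' fun t ht => ?_
      have ht' : 0 ≤ t ∧ D ∉ bad t := by
        simp only [hB, Set.mem_union, not_or] at hDB
        rcases ht with rfl | rfl | rfl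
        · exact ⟨ht₀pos.le, hDB.1⟩
        · exact ⟨by linarith, hDB.2.1⟩
        · exact ⟨by linarith, hDB.2.2⟩
      have h1 : |empG s grid a b D.1 D.2 t -
          ∫ w, gridLength s grid a b t w ∂(μ.prod (unifLaw u))| < κ := not_le.1 ht'.2
      have h2 := abs_integral_gridLength_sub_popG_le (μ := μ) hu hs0.le ha hb hM hg ht'.1
      have h3 := abs_sub_le (empG s grid a b D.1 D.2 t)
        (∫ w, gridLength s grid a b t w ∂(μ.prod (unifLaw u))) (popG μ u s a b t).toReal
      -- The allowed 2κ splits into κ for sampling and 4s/M ≤ κ for the grid.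
      linarith
  refine (lintegral_mono_ae hpt).trans ?_
  rw [lintegral_add_left measurable_const, lintegral_const, measure_univ, mul_one,
    lintegral_indicator_const hBm, ENNReal.ofReal_mul (by positivity)]
  gcongr

end FixedLabelledSample

/-! ### Discrepancy measure controlled by estimation errors -/

section Discrepancy

variable {𝒳 : Type*} [MeasurableSpace 𝒳]

/-- Small errors at x empty the fibre by the Lipschitz bound; otherwise the fibre has length at most
2/δ, and Markov's inequality charges this to the errors. The constant does not involve s. -/
lemma exists_measure_discrepancySet_le {σ₀ δ : ℝ} (hσ₀ : 0 < σ₀) (hδ : 0 < δ) :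
    ∃ K : ℝ, ∀ (μ : Measure 𝒳) [IsProbabilityMeasure μ] (f σ a b : 𝒳 → ℝ) (s : ℝ),
      Measurable f → Measurable σ → Measurable a → Measurable b → (∀ x, σ₀ ≤ σ x) →
      (μ.prod volume) (discrepancySet f σ a b s δ) ≤
        ENNReal.ofReal K * (∫⁻ x, ENNReal.ofReal ((a x - f x) ^ 2) ∂μ +
          ∫⁻ x, ENNReal.ofReal |threshold s (b x ^ 2) - σ x ^ 2| ∂μ) := by
  obtain ⟨C, hC, hLip⟩ := exists_gaussianPDFReal_lipschitz (v₀ := σ₀ ^ 2 / 2) (by positivity)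
  -- The second term keeps the estimated variance above σ₀²/2, where the Lipschitz constant is
  -- valid; thresholding alone only gives 1/s.
  set η := min (δ / (2 * C)) (σ₀ ^ 2 / 2) with hη
  have hη0 : 0 < η := lt_min (by positivity) (by positivity)
  set K := 2 / δ * ((η ^ 2)⁻¹ + η⁻¹) with hK
  have hK0 : 0 < K := by positivity
  refine ⟨K, fun μ _ f σ a b s hf hσ ha hb hσσ => ?_⟩
  rw [Measure.prod_apply (measurableSet_discrepancySet hf hσ ha hb s δ),
    ← lintegral_add_left (by fun_prop), ← lintegral_const_mul' _ _ ENNReal.ofReal_ne_top]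
  refine lintegral_mono fun x => ?_
  rw [← ENNReal.ofReal_add (by positivity) (by positivity), ← ENNReal.ofReal_mul hK0.le]
  set v := threshold s (b x ^ 2) with hv
  have hσx : σ₀ ^ 2 ≤ σ x ^ 2 := by
    have := hσσ x
    gcongr
  by_cases hgood : |a x - f x| ≤ η ∧ |v - σ x ^ 2| ≤ η
  · have hv0 : σ₀ ^ 2 / 2 ≤ v := by
      have h1 := (abs_le.1 hgood.2).1
      have h2 : η ≤ σ₀ ^ 2 / 2 := min_le_right _ _
      linarith
    have hempty : Prod.mk x ⁻¹' discrepancySet f σ a b s δ = ∅ := by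
      refine Set.eq_empty_of_forall_notMem fun y hy => ?_
      have h1 : δ < |gaussianPDFReal (a x) v.toNNReal y - condDensity f σ x y| := hy.2
      have h2 := hLip (a x) (f x) v (σ x ^ 2) y hv0 (by nlinarith)
      have h3 : C * (|a x - f x| + |v - σ x ^ 2|) ≤ C * (δ / (2 * C) + δ / (2 * C)) := by
        have h4 : η ≤ δ / (2 * C) := min_le_left _ _
        gcongr
        · exact hgood.1.trans h4
        · exact hgood.2.trans h4
      have h5 : C * (δ / (2 * C) + δ / (2 * C)) = δ := by field_simp; ring
      exact absurd (h1.trans_le (h2.trans (h3.trans_eq h5))) (lt_irrefl _)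
    rw [hempty]
    simp
  · have hsub : Prod.mk x ⁻¹' discrepancySet f σ a b s δ ⊆
        {y | δ ≤ gaussianPDFReal (a x) v.toNNReal y} ∪
          {y | δ ≤ gaussianPDFReal (f x) (σ x ^ 2).toNNReal y} := by
      intro y hy
      have h1 : δ < |gaussianPDFReal (a x) v.toNNReal y -
        gaussianPDFReal (f x) (σ x ^ 2).toNNReal y| := hy.2
      have h2 := gaussianPDFReal_nonneg (a x) v.toNNReal y
      have h3 := gaussianPDFReal_nonneg (f x) (σ x ^ 2).toNNReal y
      rcases lt_abs.1 h1 with h | h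
      · left
        simp only [Set.mem_ofPred_eq]
        linarith
      · right
        simp only [Set.mem_ofPred_eq]
        linarith
    refine (measure_mono hsub).trans ((measure_union_le _ _).trans
      ((add_le_add (volume_le_gaussianPDFReal_le _ _ hδ) (volume_le_gaussianPDFReal_le _ _ hδ)).trans
        ?_))
    rw [← ENNReal.ofReal_add (by positivity) (by positivity)]
    apply ENNReal.ofReal_le_ofReal
    have h0 : 1 ≤ ((η ^ 2)⁻¹ + η⁻¹) * ((a x - f x) ^ 2 + |v - σ x ^ 2|) := by
      rcases not_and_or.1 hgood with h | h
      · have h1 : η ^ 2 ≤ (a x - f x) ^ 2 := by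
          rw [← sq_abs (a x - f x)]
          have := (not_le.1 h).le
          gcongr
        calc (1 : ℝ) = (η ^ 2)⁻¹ * η ^ 2 := by field_simp
          _ ≤ ((η ^ 2)⁻¹ + η⁻¹) * ((a x - f x) ^ 2 + |v - σ x ^ 2|) := by
            refine mul_le_mul ?_ ?_ (by positivity) (by positivity)
            · linarith [inv_pos.2 hη0]
            · linarith [abs_nonneg (v - σ x ^ 2)]
      · calc (1 : ℝ) = η⁻¹ * η := by field_simp
          _ ≤ ((η ^ 2)⁻¹ + η⁻¹) * ((a x - f x) ^ 2 + |v - σ x ^ 2|) := by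
            refine mul_le_mul ?_ ?_ (by positivity) (by positivity)
            · linarith [inv_pos.2 (pow_pos hη0 2)]
            · linarith [sq_nonneg (a x - f x), not_le.1 h]
    calc δ⁻¹ + δ⁻¹ = 2 / δ * 1 := by field_simp; ring
      _ ≤ 2 / δ * (((η ^ 2)⁻¹ + η⁻¹) * ((a x - f x) ^ 2 + |v - σ x ^ 2|)) := by gcongr
      _ = _ := by rw [hK]; ring

end Discrepancy

/-! ### Excess risk controlled by the symmetric difference -/

section Excess

variable {𝒳 : Type*} [MeasurableSpace 𝒳] {μ : Measure 𝒳} [IsProbabilityMeasure μ] {f σ : 𝒳 → ℝ}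

lemma lamStar_le (hf : Measurable f) (hσ : Measurable σ) {C ℓ : ℝ} (hC0 : 0 ≤ C)
    (hC : ∀ x y, condDensity f σ x y ≤ C) : lamStar μ f σ ℓ ≤ C := by
  by_contra h
  obtain ⟨t, ht1, ht2⟩ := exists_between (not_le.1 h)
  have h1 := lt_bigG_of_lt_lamStar (hC0.trans ht1.le) ht2
  have h2 : bigG μ f σ t = 0 := by
    rw [bigG_eq hf hσ]
    have : {q : 𝒳 × ℝ | t ≤ condDensity f σ q.1 q.2} = ∅ :=
      Set.eq_empty_of_forall_notMem fun q hq => not_le.2 (ht1.trans_le hq) (hC q.1 q.2)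
    rw [this, measure_empty]
  rw [h2] at h1
  exact not_lt_zero h1

variable {u ℓ C : ℝ} {Γs : 𝒳 → Set ℝ} {Γ : 𝒳 × ℝ → Set ℝ}

lemma risk_prod (hf : Measurable f) (hσ : Measurable σ) (hu : 0 < u) (lam : ℝ)
    (hΓs : MeasurablePredictor Γs) :
    risk (μ.prod (unifLaw u)) (fun w => f w.1) (fun w => σ w.1) lam (fun w => Γs w.1) =
      risk μ f σ lam Γs := by
  have := isProbabilityMeasure_unifLaw hu
  rw [risk, risk, errorRate_prod hf hσ _ hΓs, expLength_prod _ hΓs]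

lemma measurablePredictor_comp_fst (hΓs : MeasurablePredictor Γs) :
    MeasurablePredictor fun w : 𝒳 × ℝ => Γs w.1 :=
  (by fun_prop : Measurable fun q : (𝒳 × ℝ) × ℝ => (q.1.1, q.2)) hΓs

lemma excessRisk_toENNReal_le (hf : Measurable f) (hσ : Measurable σ) (hpos : ∀ x, 0 < σ x)
    (hu : 0 < u) (hlam : lamStar μ f σ ℓ ≤ C) (hC : ∀ x y, condDensity f σ x y ≤ C)
    (hΓs : MeasurablePredictor Γs) (hΓ : MeasurablePredictor Γ) :
    (excessRisk μ f σ (unifLaw u) ℓ Γs Γ).toENNReal ≤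
      ENNReal.ofReal (2 * C) * symmDiffLength μ (unifLaw u) Γs Γ := by
  have := isProbabilityMeasure_unifLaw hu
  refine toENNReal_coe_sub_le ?_
  rw [← risk_prod hf hσ hu _ hΓs]
  exact risk_le_risk_add (hf.comp measurable_fst) (hσ.comp measurable_fst) (fun w => hpos w.1) hlam
    (fun w => hC w.1) hΓ (measurablePredictor_comp_fst hΓs)

/-- The same comparison with the predictors exchanged. Optimality supplies a finite reference risk,
so that the extended subtraction can be reversed. -/
lemma neg_excessRisk_toENNReal_le (hf : Measurable f) (hσ : Measurable σ) (hpos : ∀ x, 0 < σ x)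
    (hu : 0 < u) (hlam : lamStar μ f σ ℓ ≤ C) (hC : ∀ x y, condDensity f σ x y ≤ C)
    (hΓs : IsOptimalPredictor μ f σ ℓ Γs) (hΓ : MeasurablePredictor Γ) :
    (-excessRisk μ f σ (unifLaw u) ℓ Γs Γ).toENNReal ≤
      ENNReal.ofReal (2 * C) * symmDiffLength μ (unifLaw u) Γs Γ := by
  have := isProbabilityMeasure_unifLaw hu
  have := isProbabilityMeasure_obsLaw (μ := μ) hf hσ
  refine toENNReal_neg_coe_sub_le ?_ ?_
  · refine ENNReal.add_ne_top.2 ⟨measure_ne_top _ _, ENNReal.mul_ne_top ENNReal.ofReal_ne_top ?_⟩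
    exact ne_top_of_le_ne_top ENNReal.ofReal_ne_top hΓs.2.1
  · rw [← risk_prod hf hσ hu _ hΓs.1]
    refine (risk_le_risk_add (hf.comp measurable_fst) (hσ.comp measurable_fst) (fun w => hpos w.1)
      hlam (fun w => hC w.1) (measurablePredictor_comp_fst hΓs.1) hΓ).trans_eq ?_
    simp_rw [symmDiff_comm (Γs _)]
    rfl

variable {n M : ℕ} {fh st : (Fin n → 𝒳 × ℝ) → 𝒳 → ℝ}

lemma measurablePredictor_dataPredictor {N : ℕ} (hfh : Measurable (Function.uncurry fh))
    (hst : Measurable (Function.uncurry st)) (grid : Fin M → ℝ) (ℓ : ℝ)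
    (D : (Fin n → 𝒳 × ℝ) × (Fin N → 𝒳) × (Fin N → ℝ)) :
    MeasurablePredictor (dataPredictor grid fh st ℓ D) :=
  measurablePredictor_superlevel_plugInDensity hfh.of_uncurry_left hst.of_uncurry_left _

lemma expExcessRisk_le (hf : Measurable f) (hσ : Measurable σ) (hpos : ∀ x, 0 < σ x)
    (hu : 0 < u) (hlam : lamStar μ f σ ℓ ≤ C) (hC : ∀ x y, condDensity f σ x y ≤ C)
    (hΓs : MeasurablePredictor Γs) (N : ℕ) (grid : Fin M → ℝ)
    (hfh : Measurable (Function.uncurry fh)) (hst : Measurable (Function.uncurry st)) :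
    expExcessRisk μ f σ N u grid fh st ℓ Γs ≤
      ((ENNReal.ofReal (2 * C) * expSymmDiffLength μ f σ N u grid fh st ℓ Γs : ℝ≥0∞) : EReal) := by
  unfold expSymmDiffLength
  rw [← lintegral_const_mul' _ _ ENNReal.ofReal_ne_top]
  exact eexpect_le fun D => excessRisk_toENNReal_le hf hσ hpos hu hlam hC hΓs
    (measurablePredictor_dataPredictor hfh hst grid ℓ D)

lemma neg_le_expExcessRisk (hf : Measurable f) (hσ : Measurable σ) (hpos : ∀ x, 0 < σ x)
    (hu : 0 < u) (hlam : lamStar μ f σ ℓ ≤ C) (hC : ∀ x y, condDensity f σ x y ≤ C)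
    (hΓs : IsOptimalPredictor μ f σ ℓ Γs) (N : ℕ) (grid : Fin M → ℝ)
    (hfh : Measurable (Function.uncurry fh)) (hst : Measurable (Function.uncurry st)) :
    -((ENNReal.ofReal (2 * C) * expSymmDiffLength μ f σ N u grid fh st ℓ Γs : ℝ≥0∞) : EReal) ≤
      expExcessRisk μ f σ N u grid fh st ℓ Γs := by
  unfold expSymmDiffLength
  rw [← lintegral_const_mul' _ _ ENNReal.ofReal_ne_top]
  exact neg_le_eexpect fun D => neg_excessRisk_toENNReal_le hf hσ hpos hu hlam hC hΓs
    (measurablePredictor_dataPredictor hfh hst grid ℓ D)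

end Excess

/-! ### Passage to the limit -/

section Consistency

variable {𝒳 : Type*} [MeasurableSpace 𝒳] {μ : Measure 𝒳} [IsProbabilityMeasure μ] {f σ : 𝒳 → ℝ}

/-- A bound of the conditional expectation given the labelled sample by an affine function of the
estimation errors passes to the expectation. -/
lemma expSymmDiffLength_le_of_forall {n N M : ℕ} {u ℓ : ℝ} {Γs : 𝒳 → Set ℝ}
    (hf : Measurable f) (hσ : Measurable σ) {grid : Fin M → ℝ}
    {fh st : (Fin n → 𝒳 × ℝ) → 𝒳 → ℝ}
    (hfh : Measurable (Function.uncurry fh)) (hst : Measurable (Function.uncurry st))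
    {A B : ℝ≥0∞}
    (h : ∀ D₁, ∫⁻ D, symmDiffLength μ (unifLaw u) Γs
        (empPredictor (truncLevel n N) grid (fh D₁) (st D₁) D.1 D.2 ℓ)
        ∂((Measure.pi fun _ : Fin N => μ).prod (Measure.pi fun _ : Fin N => unifLaw u)) ≤
      A + B * (∫⁻ x, ENNReal.ofReal ((fh D₁ x - f x) ^ 2) ∂μ +
          ∫⁻ x, ENNReal.ofReal |threshold (truncLevel n N) (st D₁ x ^ 2) - σ x ^ 2| ∂μ)) :
    expSymmDiffLength μ f σ N u grid fh st ℓ Γs ≤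
      A + B * (regressionError μ f σ fh + varianceError μ f σ (truncLevel n N) st) := by
  have := isProbabilityMeasure_obsLaw (μ := μ) hf hσ
  have hL : IsProbabilityMeasure (labelledLaw μ f σ n) := by
    unfold labelledLaw
    infer_instance
  have hm1 : Measurable fun D₁ => ∫⁻ x, ENNReal.ofReal ((fh D₁ x - f x) ^ 2) ∂μ := by
    refine Measurable.lintegral_prod_right'
      (f := fun q : (Fin n → 𝒳 × ℝ) × 𝒳 => ENNReal.ofReal ((fh q.1 q.2 - f q.2) ^ 2)) ?_
    exact ((hfh.sub (hf.comp measurable_snd)).pow_const 2).ennreal_ofReal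
  have hm2 : Measurable fun D₁ =>
      ∫⁻ x, ENNReal.ofReal |threshold (truncLevel n N) (st D₁ x ^ 2) - σ x ^ 2| ∂μ := by
    refine Measurable.lintegral_prod_right' (f := fun q : (Fin n → 𝒳 × ℝ) × 𝒳 =>
      ENNReal.ofReal |threshold (truncLevel n N) (st q.1 q.2 ^ 2) - σ q.2 ^ 2|) ?_
    exact ((((measurable_threshold _).comp (hst.pow_const 2)).sub
      ((hσ.comp measurable_snd).pow_const 2)).abs).ennreal_ofReal
  have hm3 : Measurable fun D₁ => ∫⁻ x, ENNReal.ofReal ((fh D₁ x - f x) ^ 2) ∂μ +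
      ∫⁻ x, ENNReal.ofReal |threshold (truncLevel n N) (st D₁ x ^ 2) - σ x ^ 2| ∂μ := hm1.add hm2
  unfold expSymmDiffLength dataLaw
  -- This direction of Tonelli needs no measurability of the length as a function of the data.
  refine (lintegral_prod_le _).trans ((lintegral_mono h).trans_eq ?_)
  rw [lintegral_add_left measurable_const, lintegral_const, measure_univ, mul_one,
    lintegral_const_mul _ hm3, lintegral_add_left hm1]
  rfl

lemma tendsto_truncLevel {N : ℕ → ℕ} (hN : Tendsto N atTop atTop) :
    Tendsto (fun n => truncLevel n (N n)) atTop atTop := by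
  have h : Tendsto (fun n => min n (N n)) atTop atTop := by
    rw [tendsto_atTop]
    intro b
    filter_upwards [eventually_ge_atTop b, hN.eventually_ge_atTop b] with n h1 h2
    exact le_min h1 h2
  exact Real.tendsto_log_atTop.comp (tendsto_natCast_atTop_atTop.comp h)

lemma truncLevel_le_log {n N : ℕ} (h : 0 < min n N) : truncLevel n N ≤ Real.log N := by
  unfold truncLevel
  apply Real.log_le_log
  · exact_mod_cast h
  · exact_mod_cast min_le_right n N

lemma tendsto_log_pow_div_natCast {N : ℕ → ℕ} (hN : Tendsto N atTop atTop) (k : ℕ) :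
    Tendsto (fun n => Real.log (N n) ^ k / N n) atTop (𝓝 0) :=
  ((Real.isLittleO_pow_log_id_atTop (n := k)).tendsto_div_nhds_zero).comp
    (tendsto_natCast_atTop_atTop.comp hN)

lemma tendsto_of_tendsto_ofReal_mul {c : ℕ → ℝ} {e : ℕ → ℝ≥0∞} (hc : ∀ᶠ n in atTop, 1 ≤ c n)
    (h : Tendsto (fun n => ENNReal.ofReal (c n) * e n) atTop (𝓝 0)) : Tendsto e atTop (𝓝 0) := by
  refine tendsto_of_tendsto_of_tendsto_of_le_of_le' tendsto_const_nhds h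
    (Eventually.of_forall fun _ => zero_le) ?_
  filter_upwards [hc] with n hn
  calc e n = 1 * e n := (one_mul _).symm
    _ ≤ _ := by
      gcongr
      exact ENNReal.one_le_ofReal.2 hn

/-- The order of choice is ε, then δ from the mass near λ*, then κ from the gaps of G at λ* ± δ, and
only then n; all constants in the bound are therefore fixed in the limit. -/
theorem tendsto_expSymmDiffLength {σ₀ : ℝ} (hσ₀ : 0 < σ₀) (hf : Measurable f) (hσ : Measurable σ)
    (hσσ : ∀ x, σ₀ ≤ σ x)
    (hc : ∀ y : ℝ, ContinuousOn (fun t : ℝ => μ {x | t ≤ condDensity f σ x y}) (Set.Ioi 0))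
    {ℓ : ℝ} (hℓ : 0 < ℓ) {Γs : 𝒳 → Set ℝ} (hΓs : IsOptimalPredictor μ f σ ℓ Γs)
    {N M : ℕ → ℕ} {u : ℕ → ℝ} {grid : (n : ℕ) → Fin (M n) → ℝ}
    {fh st : (n : ℕ) → (Fin n → 𝒳 × ℝ) → 𝒳 → ℝ}
    (hN : Tendsto N atTop atTop) (hM : ∀ n, 4 * Real.sqrt (N n) < M n)
    (hu : ∀ n, 0 < u n) (hu0 : Tendsto u atTop (𝓝 0))
    (hg : ∀ n, IsGrid (truncLevel n (N n)) (grid n))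
    (hfh : ∀ n, Measurable (Function.uncurry (fh n)))
    (hst : ∀ n, Measurable (Function.uncurry (st n)))
    (hR : Tendsto (fun n => regressionError μ f σ (fh n)) atTop (𝓝 0))
    (hV : Tendsto (fun n => varianceError μ f σ (truncLevel n (N n)) (st n)) atTop (𝓝 0)) :
    Tendsto (fun n => expSymmDiffLength μ f σ (N n) (u n) (grid n) (fh n) (st n) ℓ Γs)
      atTop (𝓝 0) := by
  have hpos : ∀ x, 0 < σ x := fun x => hσ₀.trans_le (hσσ x)
  set lam := lamStar μ f σ ℓ with hlam
  have hlam0 : 0 < lam := lamStar_pos hf hσ hpos hℓ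
  rw [ENNReal.tendsto_nhds_zero]
  intro ε hε
  obtain ⟨δ, hδ, hδlam, hδε⟩ := exists_measure_condDensity_near_le hf hσ hc hlam0
    (ENNReal.half_pos hε.ne')
  have hup : (bigG μ f σ (lam + δ)).toReal < ℓ := by
    have := bigG_lt_of_lamStar_lt hf hσ hpos hc hℓ (by linarith : lam < lam + δ)
    rwa [ENNReal.lt_ofReal_iff_toReal_lt (ne_top_of_lt this)] at this
  have hlo : ℓ < (bigG μ f σ (lam - δ)).toReal := by
    have := lt_bigG_of_lt_lamStar (μ := μ) (f := f) (σ := σ) (ℓ := ℓ) (t := lam - δ)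
      (by linarith) (by linarith)
    rwa [ENNReal.ofReal_lt_iff_lt_toReal hℓ.le (bigG_ne_top hf hσ (by linarith))] at this
  obtain ⟨κ, hκ, hκ1, hκup, hκlo⟩ : ∃ κ : ℝ, 0 < κ ∧ 2 * κ ≤ 1 ∧
      (bigG μ f σ (lam + δ)).toReal + 3 * κ ≤ ℓ ∧ ℓ + 4 * κ ≤ (bigG μ f σ (lam - δ)).toReal := by
    refine ⟨min (1 / 2) (min ((ℓ - (bigG μ f σ (lam + δ)).toReal) / 3)
      (((bigG μ f σ (lam - δ)).toReal - ℓ) / 4)), ?_, ?_, ?_, ?_⟩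
    · refine lt_min (by norm_num) (lt_min ?_ ?_) <;> apply div_pos <;> linarith
    · linarith [min_le_left (1 / 2) (min ((ℓ - (bigG μ f σ (lam + δ)).toReal) / 3)
        (((bigG μ f σ (lam - δ)).toReal - ℓ) / 4))]
    · have := (min_le_right (1 / 2) (min ((ℓ - (bigG μ f σ (lam + δ)).toReal) / 3)
        (((bigG μ f σ (lam - δ)).toReal - ℓ) / 4))).trans (min_le_left _ _)
      linarith
    · have := (min_le_right (1 / 2) (min ((ℓ - (bigG μ f σ (lam + δ)).toReal) / 3)
        (((bigG μ f σ (lam - δ)).toReal - ℓ) / 4))).trans (min_le_right _ _)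
      linarith
  obtain ⟨K, hK⟩ := exists_measure_discrepancySet_le (𝒳 := 𝒳) hσ₀ hδ
  set s : ℕ → ℝ := fun n => truncLevel n (N n) with hs
  have hsT : Tendsto s atTop atTop := tendsto_truncLevel hN
  set tail : ℕ → ℝ≥0∞ := fun n => (μ.prod volume)
    {q | s n < |q.2| ∧ lam - δ ≤ condDensity f σ q.1 q.2} with htail
  have htailT : Tendsto tail atTop (𝓝 0) :=
    (tendsto_measure_condDensity_tail hf hσ (by linarith : 0 < lam - δ)).comp hsT
  set C₁ : ℝ≥0∞ := ENNReal.ofReal (1 + (2 * ℓ + 1) / κ) * ENNReal.ofReal K with hC₁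
  -- Trivial length 2s + ℓ ≤ (2 + ℓ)s times failure probability 3(2s)²/(Nκ²), with s ≤ log N.
  set dev : ℕ → ℝ := fun n => (2 + ℓ) * (12 / κ ^ 2) * (Real.log (N n) ^ 3 / N n) with hdev
  have hdevT : Tendsto (fun n => ENNReal.ofReal (dev n)) atTop (𝓝 0) := by
    have := (tendsto_log_pow_div_natCast hN 3).const_mul ((2 + ℓ) * (12 / κ ^ 2))
    rw [mul_zero] at this
    simpa using ENNReal.tendsto_ofReal this
  have hrest : Tendsto (fun n => tail n + ENNReal.ofReal (dev n) +
      C₁ * (regressionError μ f σ (fh n) + varianceError μ f σ (s n) (st n))) atTop (𝓝 0) := by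
    have h1 := ENNReal.Tendsto.const_mul (a := C₁) (hR.add hV)
      (Or.inr (ENNReal.mul_ne_top ENNReal.ofReal_ne_top ENNReal.ofReal_ne_top))
    simpa using (htailT.add hdevT).add h1
  filter_upwards [ENNReal.tendsto_nhds_zero.1 hrest (ε / 2) (ENNReal.half_pos hε.ne'),
    hsT.eventually_ge_atTop 1, hsT.eventually_gt_atTop ((ℓ + 1) / 2),
    ENNReal.tendsto_nhds_zero.1 htailT (ENNReal.ofReal κ) (by simpa using hκ),
    hu0.eventually_le_const hδ, hN.eventually_gt_atTop 0, eventually_gt_atTop 0,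
    (tendsto_log_pow_div_natCast hN 2).eventually_le_const (pow_pos hκ 2)]
    with n hn hs1 hsℓ htκ huδ hN0 hn0 hlogκ
  have hN0' : (0 : ℝ) < N n := by exact_mod_cast hN0
  have hsqrt : 0 < √(N n : ℝ) := Real.sqrt_pos.2 hN0'
  have hM0' : (0 : ℝ) < M n := lt_of_le_of_lt (by positivity) (hM n)
  have hM0 : 0 < M n := by exact_mod_cast hM0'
  have hslog : s n ≤ Real.log (N n) := truncLevel_le_log (lt_min hn0 hN0)
  have hs0 : 0 < s n := one_pos.trans_le hs1
  -- M > 4√N reduces this to log N ≤ κ√N.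
  have hMκ : 4 * s n / M n ≤ κ := by
    have h1 : Real.log (N n) ≤ κ * √(N n : ℝ) := by
      refine (abs_le_of_sq_le_sq' ?_ (by positivity)).2
      rw [mul_pow, Real.sq_sqrt hN0'.le]
      rwa [div_le_iff₀ hN0'] at hlogκ
    rw [div_le_iff₀ hM0']
    have h2 := mul_lt_mul_of_pos_left (hM n) hκ
    linarith
  have hdevn : (2 * s n + ℓ) * (3 * ((2 * s n) ^ 2 / (N n * κ ^ 2))) ≤ dev n := by
    have h1 : 2 * s n + ℓ ≤ (2 + ℓ) * s n := by nlinarith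
    calc (2 * s n + ℓ) * (3 * ((2 * s n) ^ 2 / (N n * κ ^ 2))) ≤
          ((2 + ℓ) * s n) * (3 * ((2 * s n) ^ 2 / (N n * κ ^ 2))) := by gcongr
      _ = (2 + ℓ) * (12 / κ ^ 2) * (s n ^ 3 / N n) := by field_simp; ring
      _ ≤ dev n := by
        simp only [hdev]
        gcongr
  have hbound := expSymmDiffLength_le_of_forall (μ := μ) (f := f) (σ := σ) (N := N n) (u := u n)
    (ℓ := ℓ) (Γs := Γs) (grid := grid n) hf hσ (hfh n) (hst n)
    (A := ε / 2 + (tail n + ENNReal.ofReal (dev n))) (B := C₁) ?_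
  · refine hbound.trans ?_
    rw [add_assoc]
    exact (add_le_add le_rfl hn).trans_eq (ENNReal.add_halves ε)
  · intro D₁
    have ha : Measurable (fh n D₁) := (hfh n).of_uncurry_left
    have hb : Measurable (st n D₁) := (hst n).of_uncurry_left
    refine (lintegral_symmDiffLength_empPredictor_le hf hσ hpos hc hℓ hΓs ha hb (hu n)
      (by linarith : ℓ + 1 < 2 * s n) hM0 hN0 (hg n) hδ huδ hδlam hκ hκ1 hκup hκlo htκ hMκ).trans ?_
    calc _ ≤ ε / 2 + (tail n + ENNReal.ofReal (1 + (2 * ℓ + 1) / κ) * (ENNReal.ofReal K *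
            (∫⁻ x, ENNReal.ofReal ((fh n D₁ x - f x) ^ 2) ∂μ +
              ∫⁻ x, ENNReal.ofReal |threshold (s n) (st n D₁ x ^ 2) - σ x ^ 2| ∂μ))) +
            ENNReal.ofReal (dev n) := by
          refine add_le_add (add_le_add hδε (add_le_add le_rfl ?_)) (ENNReal.ofReal_le_ofReal hdevn)
          gcongr
          exact hK μ f σ _ _ _ hf hσ ha hb hσσ
      _ = _ := by
          rw [hC₁]
          ring

end Consistency

end PredInterval

theorem theorem1 (σ₀ : ℝ) (hσ₀ : 0 < σ₀) :
    ∃ C₂ : ℝ, 0 < C₂ ∧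
      ∀ (d : ℕ) (μ : Measure (EuclideanSpace ℝ (Fin d))) (_ : IsProbabilityMeasure μ)
        (f σ : EuclideanSpace ℝ (Fin d) → ℝ) (_ : Measurable f) (_ : Measurable σ)
        (σ₁ : ℝ) (_ : σ₀ < σ₁) (_ : ∀ x, σ₀ ≤ σ x ∧ σ x ≤ σ₁)
        (_ : Integrable f μ)
        (_ : ∀ y : ℝ, ContinuousOn (fun t : ℝ => μ {x | t ≤ condDensity f σ x y}) (Set.Ioi 0))
        (ℓ : ℝ) (_ : 0 < ℓ),
        IsOptimalPredictor μ f σ ℓ (levelPredictor μ f σ ℓ) ∧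
        ∀ (Γs : EuclideanSpace ℝ (Fin d) → Set ℝ) (_ : IsOptimalPredictor μ f σ ℓ Γs)
          (N M : ℕ → ℕ) (u : ℕ → ℝ) (grid : (n : ℕ) → Fin (M n) → ℝ)
          (fh st : (n : ℕ) → (Fin n → EuclideanSpace ℝ (Fin d) × ℝ) →
            EuclideanSpace ℝ (Fin d) → ℝ)
          (_ : Tendsto N atTop atTop)
          (_ : ∀ n, 4 * Real.sqrt (N n) < M n)
          (_ : ∀ n, 0 < u n) (_ : Tendsto u atTop (𝓝 0))
          (_ : ∀ n, IsGrid (truncLevel n (N n)) (grid n))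
          (_ : ∀ n, Measurable (Function.uncurry (fh n)))
          (_ : ∀ n, Measurable (Function.uncurry (st n)))
          (_ : Tendsto (fun n => ENNReal.ofReal (Real.sqrt (truncLevel n (N n))) *
            regressionError μ f σ (fh n)) atTop (𝓝 0))
          (_ : Tendsto (fun n => ENNReal.ofReal (truncLevel n (N n) ^ (5 / 2 : ℝ)) *
            varianceError μ f σ (truncLevel n (N n)) (st n)) atTop (𝓝 0)),
          (∀ n, expExcessRisk μ f σ (N n) (u n) (grid n) (fh n) (st n) ℓ Γs ≤
            (C₂ : EReal) *
              (expSymmDiffLength μ f σ (N n) (u n) (grid n) (fh n) (st n) ℓ Γs : EReal)) ∧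
          Tendsto (fun n => expSymmDiffLength μ f σ (N n) (u n) (grid n) (fh n) (st n) ℓ Γs)
            atTop (𝓝 0) ∧
          Tendsto (fun n => expExcessRisk μ f σ (N n) (u n) (grid n) (fh n) (st n) ℓ Γs)
            atTop (𝓝 0) := by
  -- 1/σ₀ bounds every conditional density, and hence λ* as well.
  refine ⟨2 * σ₀⁻¹, by positivity, ?_⟩
  intro d μ hμ f σ hf hσ σ₁ _ hbd _ hc ℓ hℓ
  have hσσ : ∀ x, σ₀ ≤ σ x := fun x => (hbd x).1
  have hpos : ∀ x, 0 < σ x := fun x => hσ₀.trans_le (hσσ x)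
  refine ⟨isOptimalPredictor_levelPredictor hf hσ hpos hc hℓ, ?_⟩
  intro Γs hΓs N M u grid fh st hN hM hu hu0 hg hfh hst hR hV
  have hC : ∀ x y, condDensity f σ x y ≤ σ₀⁻¹ := fun x y =>
    gaussianPDFReal_le hσ₀ (pow_le_pow_left₀ hσ₀.le (hσσ x) 2) _ _
  have hlam : lamStar μ f σ ℓ ≤ σ₀⁻¹ := lamStar_le hf hσ (by positivity) hC
  have hsT := tendsto_truncLevel hN
  have hR' := tendsto_of_tendsto_ofReal_mul (by
    filter_upwards [hsT.eventually_ge_atTop 1] with n hn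
    exact Real.one_le_sqrt.2 hn) hR
  have hV' := tendsto_of_tendsto_ofReal_mul (by
    filter_upwards [hsT.eventually_ge_atTop 1] with n hn
    exact Real.one_le_rpow hn (by norm_num)) hV
  have hH := tendsto_expSymmDiffLength hσ₀ hf hσ hσσ hc hℓ hΓs hN hM hu hu0 hg hfh hst hR' hV'
  have hle := fun n => expExcessRisk_le hf hσ hpos (hu n) hlam hC hΓs.1 (N n) (grid n) (hfh n) (hst n)
  have hge := fun n => neg_le_expExcessRisk hf hσ hpos (hu n) hlam hC hΓs (N n) (grid n) (hfh n)
    (hst n)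
  have hCH : Tendsto (fun n => ((ENNReal.ofReal (2 * σ₀⁻¹) *
      expSymmDiffLength μ f σ (N n) (u n) (grid n) (fh n) (st n) ℓ Γs : ENNReal) : EReal))
      atTop (𝓝 0) := by
    have h1 := ENNReal.Tendsto.const_mul (a := ENNReal.ofReal (2 * σ₀⁻¹)) hH
      (Or.inr ENNReal.ofReal_ne_top)
    rw [mul_zero] at h1
    exact (continuous_coe_ennreal_ereal.tendsto 0).comp h1
  refine ⟨fun n => (hle n).trans_eq ?_, hH, ?_⟩
  · rw [EReal.coe_ennreal_mul, EReal.coe_ennreal_ofReal, max_eq_left (by positivity)]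
  -- The excess risk is squeezed between two multiples of E[H], of opposite signs.
  · have hneg := (continuous_neg.tendsto (0 : EReal)).comp hCH
    rw [neg_zero] at hneg
    exact tendsto_of_tendsto_of_tendsto_of_le_of_le hneg hCH hge hle
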